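/- Let $\Theta\subset\mathbb R^p$ and $B\subset\mathbb R^L$ be compact and let $F_\theta:[-\pi,\pi]^2\to(0,\infty)$, $\theta\in\Theta$, be a family of spectral densities on the lattice $\mathbb Z^2$. Write $\gamma_{h,k}(F)=\frac1{4\pi^2}\int_{[-\pi,\pi]^2}F(\lambda)\,e^{i(h\lambda_1+k\lambda_2)}\,d\lambda$, and let $\Sigma_N(F)$ be the $N^2\times N^2$ matrix, indexed by the sites $(r,s)\in\{1,\dots,N\}^2$, with entries $\gamma_{r-r',\,s-s'}(F)$. Let $\mathcal S$ be the class of functions $F$ on $[-\pi,\pi]^2$ with $F(\lambda)=\sum_{h,k\in\mathbb Z}\gamma_{h,k}e^{-i(h\lambda_1+k\lambda_2)}$ for real coefficients $\gamma_{h,k}=\gamma_{-h,-k}$ such that $\sum_k|k||\gamma_{h,k}|<\infty$ for all $h$, $\sum_h|h||\gamma_{h,k}|<\infty$ for all $k$, and $\sum_{h,k}|h||k||\gamma_{h,k}|<\infty$. Assume (A2): $F_\theta(\lambda)$ is twice continuously differentiable in $\theta\in\Theta$, with $F_\theta$, $\nabla_\theta F_\theta$ and $\nabla_\theta\nabla_\theta'F_\theta$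 continuous in $(\theta,\lambda)\in\Theta\times[-\pi,\pi]^2$; $F_\theta(\lambda)$ is bounded above and bounded away from zero uniformly in $(\theta,\lambda)$; and $F_\theta$ and all components of $\nabla_\theta F_\theta$ and $\nabla_\theta\nabla_\theta'F_\theta$ belong to $\mathcal S$ for every $\theta\in\Theta$. Assume that the model is identifiable: for $\theta_1,\theta_2\in\Theta$, $F_{\theta_1}=F_{\theta_2}$ implies $\theta_1=\theta_2$. Let $X_1,\dots,X_L:\mathbb Z^2\to\mathbb R$ be regressors, and let $\{Y_{r,s}\}_{(r,s)\in\mathbb Z^2}$ be a Gaussian random field with $\mathbb E\,Y_{r,s}=\sum_{\ell=1}^L\tilde\beta_\ell X_\ell(r,s)$ and $\mathrm{Cov}(Y_{r,s},Y_{a,b})=\gamma_{a-r,\,b-s}(F_{\tilde\theta})$, where $\tilde\theta\in\operatorname{int}\Theta$ and $\tilde\beta\in\operatorname{int}B$ (so that the model and the regressors are correctly specified). Let $Y$ be the vector of the observations at the sites of $\{1,\dots,N\}^2$ and $X$ the $N^2\times L$ matrix with entries $X_\ell(r,s)$. Assume that for every $\theta\in\Theta$ $$N^{-2}X'\Sigma_N^{-1}(F_\theta)X\to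 M(\theta)\qquad(N\to\infty),$$ where $M(\theta)$ is positive definite with eigenvalues bounded away from $0$ and $\infty$ uniformly in $\theta\in\Theta$. Let the prior $\pi$ be a fixed probability measure on $\Theta\times B$ that gives positive mass to every neighbourhood of $(\tilde\theta,\tilde\beta)$, and let $\hat\theta_B$ and $\hat\beta_B$ be the posterior means of $\theta$ and $\beta$ given $Y$, for the posterior proportional to $e^{\mathcal L(\theta,\beta)}\,\pi(d\theta,d\beta)$ with the Gaussian log likelihood $$\mathcal L(\theta,\beta)=-\tfrac12\log|\Sigma_N(F_\theta)|-\tfrac12(Y-X\beta)'\Sigma_N^{-1}(F_\theta)(Y-X\beta).$$ Then $\hat\beta_B\to\tilde\beta$ and $\hat\theta_B\to\tilde\theta$ in probability as $N\to\infty$. -/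

import Mathlib

open MeasureTheory ProbabilityTheory Filter Topology

noncomputable section

namespace LatticeField

/-- The square `[-π, π]²` of frequencies. -/
def freqBox : Set (ℝ × ℝ) := Set.Icc (-Real.pi) Real.pi ×ˢ Set.Icc (-Real.pi) Real.pi

/-- The character `Z₁^h Z₂^k` with `Z_j = exp (-i w_j)`, at the lag `t = (h, k)`. -/
def zmon (t : ℤ × ℤ) (w : ℝ × ℝ) : ℂ :=
  Complex.exp (-Complex.I * ((t.1 : ℂ) * (w.1 : ℂ) + (t.2 : ℂ) * (w.2 : ℂ)))

/-- The autocovariance `γ_t(F) = (4π²)⁻¹ ∫∫ F(w) Z₁^{-h} Z₂^{-k} dw` at the lag `t = (h, k)`.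
For a spectrum with `F(w) = F(-w)` the integral is real; its real part is the value. -/
def acf (F : ℝ × ℝ → ℝ) (t : ℤ × ℤ) : ℝ :=
  ((4 * (Real.pi : ℂ) ^ 2)⁻¹ * ∫ w in freqBox, (F w : ℂ) * zmon (-t) w).re

/-- `F` is the Fourier series of its (real, even) coefficients `γ_{h,k}`, for which the sums
`∑_k |k| |γ_{h,k}|`, `∑_h |h| |γ_{h,k}|` and `∑_{h,k} |h| |k| |γ_{h,k}|` are finite. -/
structure SummableSpectrum (F : ℝ × ℝ → ℝ) : Prop where
  hasSum : ∀ w ∈ freqBox, HasSum (fun t : ℤ × ℤ => (acf F t : ℂ) * zmon t w) (F w : ℂ)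
  row : ∀ h : ℤ, Summable fun k : ℤ => |(k : ℝ)| * |acf F (h, k)|
  col : ∀ k : ℤ, Summable fun h : ℤ => |(h : ℝ)| * |acf F (h, k)|
  cross : Summable fun t : ℤ × ℤ => |(t.1 : ℝ)| * |(t.2 : ℝ)| * |acf F t|

/-- The class of admissible spectra: positive, with the summability conditions above. -/
structure AdmissibleSpectrum (F : ℝ × ℝ → ℝ) : Prop where
  pos : ∀ w ∈ freqBox, 0 < F w
  summable : SummableSpectrum F

/-- The regularity condition on a family of spectra `F θ`, `θ ∈ Θ`: twice continuously
differentiable in `θ` (with `F`, gradient and Hessian continuous in `(θ, w)`), uniformly bounded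
above and away from zero, every `F θ` admissible, and every component of the gradient and of the
Hessian in the class of summable spectra (derivatives of a spectrum change sign, so positivity is
not asked of them). -/
structure RegularSpectra {p : ℕ} (Θ : Set (EuclideanSpace ℝ (Fin p)))
    (F : EuclideanSpace ℝ (Fin p) → ℝ × ℝ → ℝ) : Prop where
  bounded : ∃ c C : ℝ, 0 < c ∧ ∀ θ ∈ Θ, ∀ w ∈ freqBox, c ≤ F θ w ∧ F θ w ≤ C
  admissible : ∀ θ ∈ Θ, AdmissibleSpectrum (F θ)
  continuousOn : ContinuousOn (fun q : EuclideanSpace ℝ (Fin p) × (ℝ × ℝ) => F q.1 q.2)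
    (Θ ×ˢ freqBox)
  smooth : ∃ (G : EuclideanSpace ℝ (Fin p) → ℝ × ℝ → EuclideanSpace ℝ (Fin p))
      (H : EuclideanSpace ℝ (Fin p) → ℝ × ℝ →
        (EuclideanSpace ℝ (Fin p) →L[ℝ] EuclideanSpace ℝ (Fin p))),
    (∀ θ ∈ Θ, ∀ w ∈ freqBox, HasGradientWithinAt (fun η => F η w) (G θ w) Θ θ) ∧
    (∀ θ ∈ Θ, ∀ w ∈ freqBox, HasFDerivWithinAt (fun η => G η w) (H θ w) Θ θ) ∧
    ContinuousOn (fun q : EuclideanSpace ℝ (Fin p) × (ℝ × ℝ) => G q.1 q.2) (Θ ×ˢ freqBox) ∧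
    ContinuousOn (fun q : EuclideanSpace ℝ (Fin p) × (ℝ × ℝ) => H q.1 q.2) (Θ ×ˢ freqBox) ∧
    (∀ θ ∈ Θ, ∀ i, SummableSpectrum fun w => G θ w i) ∧
    (∀ θ ∈ Θ, ∀ i j, SummableSpectrum fun w => H θ w (EuclideanSpace.single j 1) i)

/-- Distinct parameters give distinct spectra. -/
def Identifiable {p : ℕ} (Θ : Set (EuclideanSpace ℝ (Fin p)))
    (F : EuclideanSpace ℝ (Fin p) → ℝ × ℝ → ℝ) : Prop :=
  ∀ θ₁ ∈ Θ, ∀ θ₂ ∈ Θ, (∀ w ∈ freqBox, F θ₁ w = F θ₂ w) → θ₁ = θ₂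

/-- The lattice site `(r, s)`, `1 ≤ r, s ≤ N`, of an entry of the `N × N` sample. -/
def site {N : ℕ} (i : Fin N × Fin N) : ℤ × ℤ := ((i.1 : ℤ) + 1, (i.2 : ℤ) + 1)

/-- The `N² × N²` block-Toeplitz covariance matrix `Σ(F)` of the `N × N` sample. -/
def covMat (N : ℕ) (F : ℝ × ℝ → ℝ) : Matrix (Fin N × Fin N) (Fin N × Fin N) ℝ :=
  Matrix.of fun i j => acf F (site i - site j)

/-- The regression matrix: its columns are the lattice functions `X ℓ` on the `N × N` sample. -/
def regMat {L : ℕ} (N : ℕ) (X : Fin L → ℤ × ℤ → ℝ) : Matrix (Fin N × Fin N) (Fin L) ℝ :=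
  Matrix.of fun i l => X l (site i)

/-- The `N × N` sample of a lattice function, as a vector of length `N²`. -/
def sample (N : ℕ) (y : ℤ × ℤ → ℝ) (i : Fin N × Fin N) : ℝ := y (site i)

/-- The vector `Y - X β` on the `N × N` sample of `y`. -/
def residual {L : ℕ} (X : Fin L → ℤ × ℤ → ℝ) (N : ℕ) (y : ℤ × ℤ → ℝ)
    (β : EuclideanSpace ℝ (Fin L)) : Fin N × Fin N → ℝ :=
  sample N y - (regMat N X).mulVec (fun l => β l)

/-- The Gaussian log likelihood of the `N × N` sample of `y`, up to an additive constant: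
`-½ log |Σ(F_θ)| - ½ (Y - X β)' Σ⁻¹(F_θ) (Y - X β)`. -/
def logLik {p L : ℕ} (F : EuclideanSpace ℝ (Fin p) → ℝ × ℝ → ℝ) (X : Fin L → ℤ × ℤ → ℝ)
    (N : ℕ) (y : ℤ × ℤ → ℝ) (θ : EuclideanSpace ℝ (Fin p)) (β : EuclideanSpace ℝ (Fin L)) : ℝ :=
  -(1 / 2) * Real.log (covMat N (F θ)).det
    - (1 / 2) * dotProduct (residual X N y β) (((covMat N (F θ))⁻¹).mulVec (residual X N y β))

/-- The posterior expectation of `g (θ, β)` given the `N × N` sample of `y`: the posterior is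
proportional to the likelihood times the prior. -/
def posteriorExp {p L : ℕ} {E : Type*} [NormedAddCommGroup E] [NormedSpace ℝ E]
    (F : EuclideanSpace ℝ (Fin p) → ℝ × ℝ → ℝ) (X : Fin L → ℤ × ℤ → ℝ)
    (prior : Measure (EuclideanSpace ℝ (Fin p) × EuclideanSpace ℝ (Fin L)))
    (N : ℕ) (y : ℤ × ℤ → ℝ)
    (g : EuclideanSpace ℝ (Fin p) × EuclideanSpace ℝ (Fin L) → E) : E :=
  (∫ φ, Real.exp (logLik F X N y φ.1 φ.2) ∂prior)⁻¹ •
    ∫ φ, Real.exp (logLik F X N y φ.1 φ.2) • g φ ∂prior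

end LatticeField

end

/-! The log likelihood is of order `N²`. Away from the truth it falls below its value there by a
fixed multiple of `N²`, while near the truth it loses only an arbitrarily small multiple of `N²`.
The prior charges every neighbourhood of the truth, so the posterior mass of the far region is
exponentially small in `N²` and the posterior means converge (`norm_gibbs_mean_sub_le`).

For one wrong parameter, a basis that diagonalises both covariance matrices turns the log likelihood
ratio into a sum over independent standard normals. Its mean has two nonpositive parts: an entropy
term in the relative eigenvalues and minus a generalised least squares form. If the spectra differ,
some autocovariance differs; that lag occurs about `N²` times in the matrix, so the Frobenius
distance, and with it the entropy, is of order `N²` (`exists_entropy_ge`). If only the regression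
coefficients differ, positive definiteness of `M θ` gives the gap. The fluctuation has variance
O(`N²`), so Chebyshev makes it o(`N²`) (`whp_logLik_le`).

Equicontinuity of the likelihood divided by `N²` (`exists_logLik_modulus`) and compactness of `Θ ×ˢ
B` make the gap uniform over the far region (`whp_posteriorExp_sub_lt`). -/

noncomputable section

namespace LatticeField

/-! ### Simultaneous diagonalisation of two positive definite forms. -/

section Matrices

open Matrix

variable {ι : Type*} [Fintype ι]

lemma dotProduct_self_nonneg_real (v : ι → ℝ) : 0 ≤ v ⬝ᵥ v :=
  Finset.sum_nonneg fun i _ => mul_self_nonneg (v i)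

/-- The operator norm of `T` is that of its transpose. -/
lemma sum_sq_mulVec_le {T : Matrix ι ι ℝ} {C : ℝ}
    (hT : ∀ v : ι → ℝ, v ⬝ᵥ ((T * Tᵀ) *ᵥ v) ≤ C * (v ⬝ᵥ v)) (v : ι → ℝ) :
    (T *ᵥ v) ⬝ᵥ (T *ᵥ v) ≤ C * (v ⬝ᵥ v) := by
  have h1 : (T *ᵥ v) ⬝ᵥ (T *ᵥ v) = v ⬝ᵥ (Tᵀ *ᵥ (T *ᵥ v)) := by
    rw [dotProduct_mulVec v, vecMul_transpose]
  have h2 : (Tᵀ *ᵥ (T *ᵥ v)) ⬝ᵥ (Tᵀ *ᵥ (T *ᵥ v)) ≤ C * ((T *ᵥ v) ⬝ᵥ (T *ᵥ v)) := by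
    have := hT (T *ᵥ v)
    rwa [← mulVec_mulVec, dotProduct_mulVec, ← mulVec_transpose] at this
  have h3 : (v ⬝ᵥ (Tᵀ *ᵥ (T *ᵥ v))) ^ 2
      ≤ (v ⬝ᵥ v) * ((Tᵀ *ᵥ (T *ᵥ v)) ⬝ᵥ (Tᵀ *ᵥ (T *ᵥ v))) := by
    simp only [dotProduct, ← sq]
    exact Finset.sum_mul_sq_le_sq_mul_sq _ _ _
  have h4 : 0 ≤ v ⬝ᵥ v := dotProduct_self_nonneg_real v
  set q := (T *ᵥ v) ⬝ᵥ (T *ᵥ v)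
  have h5 : 0 ≤ q := dotProduct_self_nonneg_real _
  rw [← h1] at h3
  have h6 : q * q ≤ (C * (v ⬝ᵥ v)) * q := by nlinarith [mul_le_mul_of_nonneg_left h2 h4]
  -- `h6` can be divided by `q` only when `q > 0`. For `q = 0` the sign of `C * (v ⬝ᵥ v)` is still
  -- needed, and `hT v` provides it.
  rcases h5.eq_or_lt with h0 | h0
  · have h7 : (T *ᵥ v) = 0 := dotProduct_self_eq_zero.1 h0.symm
    have h8 := hT v
    rw [← mulVec_mulVec, dotProduct_mulVec, ← mulVec_transpose] at h8
    rw [← h0]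
    exact (dotProduct_self_nonneg_real _).trans h8
  · exact le_of_mul_le_mul_right h6 h0

/-- The squared Frobenius norm of `T * K`. -/
lemma frobenius_mul_le {T : Matrix ι ι ℝ} {C : ℝ}
    (hT : ∀ v : ι → ℝ, (T *ᵥ v) ⬝ᵥ (T *ᵥ v) ≤ C * (v ⬝ᵥ v)) (K : Matrix ι ι ℝ) :
    ∑ i, ∑ j, (T * K) i j ^ 2 ≤ C * ∑ i, ∑ j, K i j ^ 2 := by
  rw [Finset.sum_comm, Finset.sum_comm (f := fun i j => K i j ^ 2), Finset.mul_sum]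
  refine Finset.sum_le_sum fun j _ => ?_
  have := hT (fun i => K i j)
  simpa only [dotProduct, mulVec, ← sq, mul_apply] using this

variable [DecidableEq ι]

/-- Orthogonal diagonalisation of a real positive definite matrix. -/
lemma exists_orthogonal_diagonal {A : Matrix ι ι ℝ} (hA : A.PosDef) :
    ∃ (O : Matrix ι ι ℝ) (e : ι → ℝ), O * Oᵀ = 1 ∧ (∀ i, 0 < e i) ∧
      A = O * diagonal e * Oᵀ := by
  refine ⟨hA.1.eigenvectorUnitary, hA.1.eigenvalues, ?_, fun i => hA.eigenvalues_pos i, ?_⟩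
  · have := Unitary.coe_mul_star_self hA.1.eigenvectorUnitary
    rwa [Unitary.coe_star, star_eq_conjTranspose, conjTranspose_eq_transpose_of_trivial] at this
  · conv_lhs => rw [hA.1.spectral_theorem]
    rw [Unitary.conjStarAlgAut_apply, star_eq_conjTranspose,
      conjTranspose_eq_transpose_of_trivial]
    rfl

/-- `T`, with inverse `U`, reduces `A` to the identity and `B` to the diagonal matrix of `e`. -/
structure SimDiag (A B T U : Matrix ι ι ℝ) (e : ι → ℝ) : Prop where
  mul_inv : T * U = 1
  left : A = T * Tᵀ
  right : B = T * diagonal e * Tᵀ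
  pos : ∀ i, 0 < e i

/-- Whiten `A` by a square root `S = O √a`, then rotate by the eigenvectors `Q` of the whitened `B`;
the rotation leaves the identity unchanged, so `T = S Q`. -/
lemma exists_simDiag {A B : Matrix ι ι ℝ} (hA : A.PosDef) (hB : B.PosDef) :
    ∃ T U e, SimDiag A B T U e := by
  obtain ⟨O, a, hO, ha, hAO⟩ := exists_orthogonal_diagonal hA
  set s : ι → ℝ := fun i => √(a i)
  have hs0 : ∀ i, s i ≠ 0 := fun i => (Real.sqrt_pos.2 (ha i)).ne'
  set S := O * diagonal s with hS
  set V := diagonal (fun i => (s i)⁻¹) * Oᵀ with hV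
  have hd : diagonal s * diagonal (fun i => (s i)⁻¹) = (1 : Matrix ι ι ℝ) := by
    rw [diagonal_mul_diagonal, ← diagonal_one]
    congr 1; funext i; exact mul_inv_cancel₀ (hs0 i)
  have hSV : S * V = 1 := by
    calc S * V = O * (diagonal s * diagonal (fun i => (s i)⁻¹)) * Oᵀ := by
          simp only [hS, hV, Matrix.mul_assoc]
      _ = 1 := by rw [hd, Matrix.mul_one, hO]
  have hVS : V * S = 1 := mul_eq_one_comm.mp hSV
  have hAS : A = S * Sᵀ := by
    rw [hAO, hS, transpose_mul, diagonal_transpose]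
    have : diagonal a = diagonal s * diagonal s := by
      rw [diagonal_mul_diagonal]; congr 1; funext i
      exact (Real.mul_self_sqrt (ha i).le).symm
    rw [this]; simp only [Matrix.mul_assoc]
  have hK : (V * B * Vᵀ).PosDef := by
    have := hB.mul_mul_conjTranspose_same (B := V) (fun x y hxy => by
      have h2 := congrArg (fun z => z ᵥ* S) hxy
      simpa [vecMul_vecMul, hVS] using h2)
    rwa [conjTranspose_eq_transpose_of_trivial] at this
  obtain ⟨Q, e, hQ, he, hKQ⟩ := exists_orthogonal_diagonal hK
  have hSV' : Vᵀ * Sᵀ = 1 := by rw [← transpose_mul, hSV, transpose_one]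
  refine ⟨S * Q, Qᵀ * V, e, ?_, ?_, ?_, he⟩
  · calc S * Q * (Qᵀ * V) = S * (Q * Qᵀ) * V := by simp only [Matrix.mul_assoc]
      _ = 1 := by rw [hQ, Matrix.mul_one, hSV]
  · calc A = S * (Q * Qᵀ) * Sᵀ := by rw [hQ, Matrix.mul_one, hAS]
      _ = _ := by rw [transpose_mul S Q]; simp only [Matrix.mul_assoc]
  · calc B = (S * V) * B * (Vᵀ * Sᵀ) := by rw [hSV, hSV', Matrix.one_mul, Matrix.mul_one]
      _ = S * (V * B * Vᵀ) * Sᵀ := by simp only [Matrix.mul_assoc]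
      _ = _ := by rw [hKQ, transpose_mul S Q]; simp only [Matrix.mul_assoc]

namespace SimDiag

variable {A B T U : Matrix ι ι ℝ} {e : ι → ℝ}

lemma inv_mul (h : SimDiag A B T U e) : U * T = 1 := mul_eq_one_comm.mp h.mul_inv

lemma transpose_mul_inv (h : SimDiag A B T U e) : Tᵀ * Uᵀ = 1 := by
  rw [← transpose_mul, h.inv_mul, transpose_one]

lemma conj_left (h : SimDiag A B T U e) : U * A * Uᵀ = 1 := by
  calc U * A * Uᵀ = (U * T) * (Tᵀ * Uᵀ) := by rw [h.left]; simp only [Matrix.mul_assoc]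
    _ = 1 := by rw [h.inv_mul, h.transpose_mul_inv, Matrix.one_mul]

lemma inv_left (h : SimDiag A B T U e) : A⁻¹ = Uᵀ * U := by
  refine inv_eq_right_inv ?_
  calc A * (Uᵀ * U) = T * (Tᵀ * Uᵀ) * U := by rw [h.left]; simp only [Matrix.mul_assoc]
    _ = 1 := by rw [h.transpose_mul_inv, Matrix.mul_one, h.mul_inv]

lemma inv_right (h : SimDiag A B T U e) : B⁻¹ = Uᵀ * diagonal (fun i => (e i)⁻¹) * U := by
  refine inv_eq_right_inv ?_
  have hd : diagonal e * diagonal (fun i => (e i)⁻¹) = (1 : Matrix ι ι ℝ) := by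
    rw [diagonal_mul_diagonal, ← diagonal_one]
    congr 1; funext i; exact mul_inv_cancel₀ (h.pos i).ne'
  calc B * (Uᵀ * diagonal (fun i => (e i)⁻¹) * U)
      = T * (diagonal e * ((Tᵀ * Uᵀ) * diagonal (fun i => (e i)⁻¹))) * U := by
        rw [h.right]; simp only [Matrix.mul_assoc]
    _ = 1 := by rw [h.transpose_mul_inv, Matrix.one_mul, hd, Matrix.mul_one, h.mul_inv]

lemma quad_inv_left (h : SimDiag A B T U e) (x : ι → ℝ) :
    x ⬝ᵥ (A⁻¹ *ᵥ x) = ∑ i, (U *ᵥ x) i ^ 2 := by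
  rw [h.inv_left, ← mulVec_mulVec, dotProduct_mulVec, vecMul_transpose]
  simp only [dotProduct, sq]

lemma quad_inv_right (h : SimDiag A B T U e) (x : ι → ℝ) :
    x ⬝ᵥ (B⁻¹ *ᵥ x) = ∑ i, (e i)⁻¹ * (U *ᵥ x) i ^ 2 := by
  rw [h.inv_right, ← mulVec_mulVec, ← mulVec_mulVec, dotProduct_mulVec, vecMul_transpose]
  simp only [dotProduct, mulVec_diagonal]
  exact Finset.sum_congr rfl fun i _ => by ring

lemma log_det (h : SimDiag A B T U e) :
    Real.log B.det = Real.log A.det + ∑ i, Real.log (e i) := by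
  have hT : T.det ≠ 0 := by
    have := congrArg det h.mul_inv
    rw [det_mul, det_one] at this
    exact left_ne_zero_of_mul_eq_one this
  have h1 : B.det = A.det * ∏ i, e i := by
    rw [h.left, h.right]; simp only [det_mul, det_transpose, det_diagonal]; ring
  have h2 : A.det ≠ 0 := by
    rw [h.left, det_mul, det_transpose]; exact mul_ne_zero hT hT
  rw [h1, Real.log_mul h2 (Finset.prod_ne_zero_iff.2 fun i _ => (h.pos i).ne'),
    Real.log_prod fun i _ => (h.pos i).ne']

/-- The dual basis vector, on which the forms of `A` and `B` take the values `1` and `e i`. -/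
lemma exists_test_vector (h : SimDiag A B T U e) (i : ι) :
    ∃ v : ι → ℝ, v ⬝ᵥ (A *ᵥ v) = 1 ∧ v ⬝ᵥ (B *ᵥ v) = e i := by
  have hT : Tᵀ *ᵥ (Uᵀ *ᵥ Pi.single i 1) = Pi.single i 1 := by
    rw [mulVec_mulVec, h.transpose_mul_inv, one_mulVec]
  refine ⟨Uᵀ *ᵥ Pi.single i 1, ?_, ?_⟩
  · rw [h.left, ← mulVec_mulVec, dotProduct_mulVec, ← mulVec_transpose, hT]
    simp
  · rw [h.right, ← mulVec_mulVec, ← mulVec_mulVec, dotProduct_mulVec, ← mulVec_transpose, hT]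
    simp

/-- The `e i` are the eigenvalues of `B` relative to `A`, so bounds between the two forms, hence
between two spectra, become bounds on every `e i`. -/
lemma eigen_le (h : SimDiag A B T U e) {k : ℝ}
    (hk : ∀ v : ι → ℝ, v ⬝ᵥ (B *ᵥ v) ≤ k * (v ⬝ᵥ (A *ᵥ v))) (i : ι) : e i ≤ k := by
  obtain ⟨v, h1, h2⟩ := h.exists_test_vector i
  simpa [h1, h2] using hk v

lemma inv_eigen_le (h : SimDiag A B T U e) {k : ℝ}
    (hk : ∀ v : ι → ℝ, v ⬝ᵥ (A *ᵥ v) ≤ k * (v ⬝ᵥ (B *ᵥ v))) (i : ι) : (e i)⁻¹ ≤ k := by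
  obtain ⟨v, h1, h2⟩ := h.exists_test_vector i
  have := hk v
  rw [h1, h2] at this
  rwa [inv_le_iff_one_le_mul₀ (h.pos i)]

end SimDiag

/-- Since `A - B = T (1 - diagonal e) Tᵀ`, each outer factor costs one `C` in squared Frobenius
norm. Read backwards: matrices that are far apart have relative eigenvalues far from one. -/
lemma SimDiag.frobenius_sub_le {A B T U : Matrix ι ι ℝ} {e : ι → ℝ} (h : SimDiag A B T U e)
    {C : ℝ} (hC : 0 ≤ C) (hA : ∀ v : ι → ℝ, v ⬝ᵥ (A *ᵥ v) ≤ C * (v ⬝ᵥ v)) :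
    ∑ i, ∑ j, (A i j - B i j) ^ 2 ≤ C ^ 2 * ∑ i, (e i - 1) ^ 2 := by
  have hT := sum_sq_mulVec_le (T := T) (C := C) (by rwa [← h.left])
  set K : Matrix ι ι ℝ := diagonal (fun i => 1 - e i)
  have hAB : A - B = T * (K * Tᵀ) := by
    have : K = 1 - diagonal e := by rw [← diagonal_one, diagonal_sub]
    rw [this, Matrix.sub_mul, Matrix.mul_sub, Matrix.one_mul, ← h.left, ← Matrix.mul_assoc,
      ← h.right]
  -- `K` is diagonal, so the two products are transposes of each other and left multiplication
  -- bounds suffice.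
  have h2 : ∑ i, ∑ j, (K * Tᵀ) i j ^ 2 = ∑ i, ∑ j, (T * K) i j ^ 2 := by
    rw [Finset.sum_comm]
    refine Finset.sum_congr rfl fun i _ => Finset.sum_congr rfl fun j _ => ?_
    simp only [K, diagonal_mul, mul_diagonal, transpose_apply]; ring
  have h3 : ∑ i, ∑ j, K i j ^ 2 = ∑ i, (e i - 1) ^ 2 := by
    refine Finset.sum_congr rfl fun i _ => ?_
    rw [Finset.sum_eq_single i]
    · simp only [K, diagonal_apply_eq]; ring
    · intro j _ hj; simp [K, diagonal_apply_ne _ hj.symm]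
    · simp
  calc ∑ i, ∑ j, (A i j - B i j) ^ 2 = ∑ i, ∑ j, (T * (K * Tᵀ)) i j ^ 2 := by
        simp only [← hAB, Matrix.sub_apply]
    _ ≤ C * ∑ i, ∑ j, (K * Tᵀ) i j ^ 2 := frobenius_mul_le hT _
    _ ≤ C * (C * ∑ i, ∑ j, K i j ^ 2) := by
        rw [h2]; exact mul_le_mul_of_nonneg_left (frobenius_mul_le hT _) hC
    _ = C ^ 2 * ∑ i, (e i - 1) ^ 2 := by rw [h3]; ring

end Matrices

/-! ### Spectra and their block-Toeplitz covariance matrices. -/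

section Covariance

open Matrix

/-- The phase `h λ₁ + k λ₂` at the lag `t = (h, k)`. -/
def phase (t : ℤ × ℤ) (w : ℝ × ℝ) : ℝ := t.1 * w.1 + t.2 * w.2

lemma continuous_phase (t : ℤ × ℤ) : Continuous (phase t) := by
  unfold phase; fun_prop

lemma phase_sub (s t : ℤ × ℤ) (w : ℝ × ℝ) : phase (s - t) w = phase s w - phase t w := by
  simp only [phase, Prod.fst_sub, Prod.snd_sub, Int.cast_sub]; ring

lemma zmon_eq (t : ℤ × ℤ) (w : ℝ × ℝ) :
    zmon t w = Complex.exp (((-phase t w : ℝ) : ℂ) * Complex.I) := by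
  simp only [zmon, phase]; push_cast; ring_nf

lemma isCompact_freqBox : IsCompact freqBox := isCompact_Icc.prod isCompact_Icc

lemma measurableSet_freqBox : MeasurableSet freqBox := isCompact_freqBox.isClosed.measurableSet

lemma integrableOn_mul_continuous {F g : ℝ × ℝ → ℝ} (hF : IntegrableOn F freqBox)
    (hg : Continuous g) : IntegrableOn (fun w => F w * g w) freqBox :=
  hF.mul_continuousOn hg.continuousOn isCompact_freqBox

lemma acf_eq {F : ℝ × ℝ → ℝ} (hF : IntegrableOn F freqBox) (t : ℤ × ℤ) :
    acf F t = (4 * Real.pi ^ 2)⁻¹ * ∫ w in freqBox, F w * Real.cos (phase t w) := by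
  have hz : ∀ w, zmon (-t) w = Complex.exp ((phase t w : ℂ) * Complex.I) := by
    intro w
    rw [zmon_eq]; congr 2
    simp only [phase, Prod.fst_neg, Prod.snd_neg]; push_cast; ring
  have hint : IntegrableOn (fun w => (F w : ℂ) * zmon (-t) w) freqBox := by
    refine IntegrableOn.mul_continuousOn (Integrable.ofReal hF) ?_ isCompact_freqBox
    have h1 : zmon (-t) = fun w => Complex.exp ((phase t w : ℂ) * Complex.I) := funext hz
    rw [h1]
    have := continuous_phase t
    fun_prop
  have hre : ∀ w, ((F w : ℂ) * zmon (-t) w).re = F w * Real.cos (phase t w) := by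
    intro w
    rw [hz, Complex.re_ofReal_mul, Complex.exp_ofReal_mul_I_re]
  have hc : (4 * (Real.pi : ℂ) ^ 2)⁻¹ = (((4 * Real.pi ^ 2)⁻¹ : ℝ) : ℂ) := by push_cast; rfl
  rw [acf, hc, Complex.re_ofReal_mul]
  congr 1
  have := integral_re (𝕜 := ℂ) hint
  simp only [RCLike.re_to_complex] at this
  rw [← this]
  simp only [hre]

lemma acf_neg {F : ℝ × ℝ → ℝ} (hF : IntegrableOn F freqBox) (t : ℤ × ℤ) :
    acf F (-t) = acf F t := by
  have : ∀ w, phase (-t) w = -phase t w := by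
    intro w; simp only [phase, Prod.fst_neg, Prod.snd_neg]; push_cast; ring
  simp only [acf_eq hF, this, Real.cos_neg]

lemma covMat_transpose {F : ℝ × ℝ → ℝ} (hF : IntegrableOn F freqBox) (N : ℕ) :
    (covMat N F)ᵀ = covMat N F := by
  ext i j
  simp only [transpose_apply, covMat, of_apply]
  rw [← acf_neg hF, neg_sub]

/-- The quadratic form of the covariance matrix is an integral against the spectrum. -/
lemma quad_covMat {F : ℝ × ℝ → ℝ} (hF : IntegrableOn F freqBox) (N : ℕ)
    (v : Fin N × Fin N → ℝ) :
    v ⬝ᵥ (covMat N F *ᵥ v) = (4 * Real.pi ^ 2)⁻¹ * ∫ w in freqBox, F w *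
      ((∑ i, v i * Real.cos (phase (site i) w)) ^ 2 +
        (∑ i, v i * Real.sin (phase (site i) w)) ^ 2) := by
  -- The bracket is the squared modulus of the trigonometric polynomial with coefficients `v`.
  have h1 : ∀ w, F w * ((∑ i, v i * Real.cos (phase (site i) w)) ^ 2 +
        (∑ i, v i * Real.sin (phase (site i) w)) ^ 2)
      = ∑ i, ∑ j, F w * (v i * v j * Real.cos (phase (site i - site j) w)) := by
    intro w
    simp only [phase_sub, Real.cos_sub]
    rw [sq, sq, Finset.sum_mul_sum, Finset.sum_mul_sum, ← Finset.sum_add_distrib, Finset.mul_sum]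
    simp only [← Finset.sum_add_distrib, Finset.mul_sum]
    exact Finset.sum_congr rfl fun i _ => Finset.sum_congr rfl fun j _ => by ring
  simp only [h1]
  have hc : ∀ i j : Fin N × Fin N,
      IntegrableOn (fun w => F w * (v i * v j * Real.cos (phase (site i - site j) w))) freqBox :=
    fun i j => integrableOn_mul_continuous hF
      (continuous_const.mul (Real.continuous_cos.comp (continuous_phase _)))
  rw [integral_finsetSum _ fun i _ => integrable_finsetSum _ fun j _ => hc i j, Finset.mul_sum]
  simp only [dotProduct, mulVec, covMat, of_apply]
  refine Finset.sum_congr rfl fun i _ => ?_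
  rw [integral_finsetSum _ fun j _ => hc i j, Finset.mul_sum, Finset.mul_sum]
  refine Finset.sum_congr rfl fun j _ => ?_
  have h2 : ∀ w, F w * (v i * v j * Real.cos (phase (site i - site j) w))
      = (v i * v j) * (F w * Real.cos (phase (site i - site j) w)) := fun w => by ring
  simp only [h2]
  rw [acf_eq hF, integral_const_mul]
  ring

/-- A comparison of spectra is inherited by the covariance matrices. -/
lemma quad_covMat_le {F G : ℝ × ℝ → ℝ} (hF : IntegrableOn F freqBox)
    (hG : IntegrableOn G freqBox) {k : ℝ} (h : ∀ w ∈ freqBox, F w ≤ k * G w) (N : ℕ)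
    (v : Fin N × Fin N → ℝ) :
    v ⬝ᵥ (covMat N F *ᵥ v) ≤ k * (v ⬝ᵥ (covMat N G *ᵥ v)) := by
  rw [quad_covMat hF, quad_covMat hG, mul_left_comm]
  refine mul_le_mul_of_nonneg_left ?_ (by positivity)
  rw [← integral_const_mul]
  have hc : Continuous fun w => (∑ i, v i * Real.cos (phase (site i) w)) ^ 2 +
        (∑ i, v i * Real.sin (phase (site i) w)) ^ 2 := by
    have := fun i : Fin N × Fin N => continuous_phase (site i)
    fun_prop
  refine setIntegral_mono_on (integrableOn_mul_continuous hF hc)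
    ((integrableOn_mul_continuous hG hc).const_mul k) measurableSet_freqBox fun w hw => ?_
  rw [← mul_assoc]
  exact mul_le_mul_of_nonneg_right (h w hw) (by positivity)

lemma integral_cos_int_mul {h : ℤ} (hh : h ≠ 0) :
    ∫ x in Set.Icc (-Real.pi) Real.pi, Real.cos (h * x) = 0 := by
  have h0 : (h : ℝ) ≠ 0 := by exact_mod_cast hh
  rw [integral_Icc_eq_integral_Ioc,
    ← intervalIntegral.integral_of_le (by linarith [Real.pi_pos]),
    intervalIntegral.integral_comp_mul_left (fun x => Real.cos x) h0, integral_cos]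
  simp [Real.sin_int_mul_pi]

lemma integral_sin_int_mul (h : ℤ) :
    ∫ x in Set.Icc (-Real.pi) Real.pi, Real.sin (h * x) = 0 := by
  rcases eq_or_ne h 0 with rfl | hh
  · simp
  have h0 : (h : ℝ) ≠ 0 := by exact_mod_cast hh
  rw [integral_Icc_eq_integral_Ioc,
    ← intervalIntegral.integral_of_le (by linarith [Real.pi_pos]),
    intervalIntegral.integral_comp_mul_left (fun x => Real.sin x) h0, integral_sin]
  simp

lemma integral_cos_phase (t : ℤ × ℤ) :
    ∫ w in freqBox, Real.cos (phase t w) =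
      (∫ x in Set.Icc (-Real.pi) Real.pi, Real.cos (t.1 * x)) *
        ∫ y in Set.Icc (-Real.pi) Real.pi, Real.cos (t.2 * y) := by
  have hcs : ∀ w, Real.cos (phase t w) = Real.cos (t.1 * w.1) * Real.cos (t.2 * w.2)
      - Real.sin (t.1 * w.1) * Real.sin (t.2 * w.2) := fun w => Real.cos_add _ _
  simp only [hcs]
  rw [integral_sub, freqBox, Measure.volume_eq_prod,
    setIntegral_prod_mul (fun x => Real.cos (t.1 * x)) (fun y => Real.cos (t.2 * y)),
    setIntegral_prod_mul (fun x => Real.sin (t.1 * x)) (fun y => Real.sin (t.2 * y)),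
    integral_sin_int_mul, zero_mul, sub_zero]
  · exact ContinuousOn.integrableOn_compact isCompact_freqBox (by fun_prop)
  · exact ContinuousOn.integrableOn_compact isCompact_freqBox (by fun_prop)

lemma integrableOn_one_freqBox : IntegrableOn (fun _ : ℝ × ℝ => (1 : ℝ)) freqBox :=
  ContinuousOn.integrableOn_compact isCompact_freqBox continuousOn_const

lemma acf_one (t : ℤ × ℤ) : acf (fun _ => 1) t = if t = 0 then 1 else 0 := by
  rw [acf_eq integrableOn_one_freqBox]
  simp only [one_mul, integral_cos_phase]
  split_ifs with h
  · subst h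
    have := Real.pi_pos
    simp [Real.volume_real_Icc_of_le (show -Real.pi ≤ Real.pi by linarith)]
    field_simp; ring
  · have : t.1 ≠ 0 ∨ t.2 ≠ 0 := by
      by_contra! h'
      exact h (Prod.ext h'.1 h'.2)
    rcases this with h' | h' <;> simp [integral_cos_int_mul h']

lemma site_injective {N : ℕ} : Function.Injective (site (N := N)) := by
  intro i j h
  simp only [site, Prod.mk.injEq, add_left_inj, Nat.cast_inj] at h
  exact Prod.ext (Fin.ext h.1) (Fin.ext h.2)

/-- The constant spectrum is white noise; constant bounds on a spectrum thereby become bounds of its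
covariance form by multiples of the identity. -/
lemma covMat_one (N : ℕ) : covMat N (fun _ => 1) = 1 := by
  ext i j
  simp only [covMat, of_apply, acf_one, sub_eq_zero, site_injective.eq_iff, one_apply]

lemma quad_covMat_le_const {F : ℝ × ℝ → ℝ} (hF : IntegrableOn F freqBox) {C : ℝ}
    (h : ∀ w ∈ freqBox, F w ≤ C) (N : ℕ) (v : Fin N × Fin N → ℝ) :
    v ⬝ᵥ (covMat N F *ᵥ v) ≤ C * (v ⬝ᵥ v) := by
  have := quad_covMat_le hF integrableOn_one_freqBox (k := C) (by simpa using h) N v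
  rwa [covMat_one, one_mulVec] at this

lemma const_le_quad_covMat {F : ℝ × ℝ → ℝ} (hF : IntegrableOn F freqBox) {c : ℝ} (hc : 0 < c)
    (h : ∀ w ∈ freqBox, c ≤ F w) (N : ℕ) (v : Fin N × Fin N → ℝ) :
    v ⬝ᵥ v ≤ c⁻¹ * (v ⬝ᵥ (covMat N F *ᵥ v)) := by
  have := quad_covMat_le integrableOn_one_freqBox hF (k := c⁻¹) (fun w hw => by
    rw [← div_eq_inv_mul, one_le_div hc]; exact h w hw) N v
  rwa [covMat_one, one_mulVec] at this

lemma posDef_covMat {F : ℝ × ℝ → ℝ} (hF : IntegrableOn F freqBox) {c : ℝ} (hc : 0 < c)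
    (h : ∀ w ∈ freqBox, c ≤ F w) (N : ℕ) : (covMat N F).PosDef := by
  refine PosDef.of_dotProduct_mulVec_pos ?_ fun v hv => ?_
  · rw [IsHermitian, conjTranspose_eq_transpose_of_trivial, covMat_transpose hF]
  · rw [star_trivial]
    have h1 := const_le_quad_covMat hF hc h N v
    have h2 : 0 < v ⬝ᵥ v := lt_of_le_of_ne (dotProduct_self_nonneg_real v)
      fun h0 => hv (dotProduct_self_eq_zero.1 h0.symm)
    exact pos_of_mul_pos_right (h2.trans_le h1) (inv_pos.2 hc).le

/-- Every lag `h` is attained by `N - |h|` pairs of points of `{0, …, N-1}`. -/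
lemma exists_lag_pairs (N : ℕ) (h : ℤ) :
    ∃ a b : Fin (N - h.natAbs) → Fin N, Function.Injective a ∧
      ∀ x, ((a x : ℕ) : ℤ) - ((b x : ℕ) : ℤ) = h := by
  -- Shift by the positive and the negative part of `h`, one of which is zero.
  refine ⟨fun x => ⟨x + h.toNat, by omega⟩, fun x => ⟨x + (-h).toNat, by omega⟩, ?_, ?_⟩
  · intro x y hxy
    simp only [Fin.mk.injEq] at hxy
    exact Fin.ext (by omega)
  · intro x
    simp only
    omega

/-- Only the entries at lag `t` are kept; by the Toeplitz structure they are all equal. Truncated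
subtraction makes the bound trivial when the lag does not fit in the sample. -/
lemma frobenius_covMat_sub_ge (F G : ℝ × ℝ → ℝ) (t : ℤ × ℤ) (N : ℕ) :
    ((N - t.1.natAbs : ℕ) : ℝ) * ((N - t.2.natAbs : ℕ) : ℝ) * (acf F t - acf G t) ^ 2 ≤
      ∑ i, ∑ j, (covMat N F i j - covMat N G i j) ^ 2 := by
  obtain ⟨a, b, ha, hab⟩ := exists_lag_pairs N t.1
  obtain ⟨a', b', ha', hab'⟩ := exists_lag_pairs N t.2
  let f : Fin (N - t.1.natAbs) × Fin (N - t.2.natAbs) →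
      (Fin N × Fin N) × (Fin N × Fin N) := fun x => ((a x.1, a' x.2), (b x.1, b' x.2))
  have hf : Function.Injective f := by
    intro x y hxy
    simp only [f, Prod.mk.injEq] at hxy
    exact Prod.ext (ha hxy.1.1) (ha' hxy.1.2)
  have hs : ∀ x, site (f x).1 - site (f x).2 = t := by
    intro x
    refine Prod.ext ?_ ?_
    · simp only [f, site, Prod.fst_sub]; linarith [hab x.1]
    · simp only [f, site, Prod.snd_sub]; linarith [hab' x.2]
  rw [← Fintype.sum_prod_type' (f := fun i j => (covMat N F i j - covMat N G i j) ^ 2)]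
  calc _ = ∑ x, (covMat N F (f x).1 (f x).2 - covMat N G (f x).1 (f x).2) ^ 2 := by
        simp only [covMat, of_apply, hs]
        simp [Fintype.card_prod]
    _ = ∑ q ∈ Finset.univ.image f, (covMat N F q.1 q.2 - covMat N G q.1 q.2) ^ 2 :=
        (Finset.sum_image (f := fun q : (Fin N × Fin N) × (Fin N × Fin N) =>
          (covMat N F q.1 q.2 - covMat N G q.1 q.2) ^ 2) hf.injOn).symm
    _ ≤ _ := Finset.sum_le_sum_of_subset_of_nonneg (Finset.subset_univ _)
        fun _ _ _ => sq_nonneg _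

/-- Both functions are the sums of their Fourier series, so the coefficients determine them. -/
lemma exists_acf_ne {F G : ℝ × ℝ → ℝ} (hF : SummableSpectrum F) (hG : SummableSpectrum G)
    (h : ¬ ∀ w ∈ freqBox, F w = G w) : ∃ t, acf F t ≠ acf G t := by
  by_contra! h'
  refine h fun w hw => ?_
  have h1 := hF.hasSum w hw
  simp only [h'] at h1
  exact_mod_cast h1.unique (hG.hasSum w hw)

end Covariance

/-! ### Quadratic polynomials in independent standard normals. -/

section Gaussian

open Matrix

lemma memLp_sq_gaussianReal : MemLp (fun x : ℝ => x ^ 2) 2 (gaussianReal 0 1) := by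
  have h4 : MemLp (id : ℝ → ℝ) 4 (gaussianReal 0 1) := memLp_id_gaussianReal' 4 (by simp)
  -- Hölder with 1/4 + 1/4 = 1/2: the square is in L² because the identity is in L⁴.
  have : ENNReal.HolderTriple 4 4 2 := ⟨by
    rw [show (4 : ENNReal) = 2 * 2 by norm_num,
      ENNReal.mul_inv (by simp) (by simp), ← mul_add, ENNReal.inv_two_add_inv_two, mul_one]⟩
  have h := h4.mul (p := 4) (q := 4) (r := 2) h4
  refine h.congr_norm (by fun_prop) (ae_of_all _ fun x => ?_)
  simp [sq]

lemma integral_sq_gaussianReal : ∫ x, x ^ 2 ∂(gaussianReal 0 1) = 1 := by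
  have h := variance_of_integral_eq_zero (X := (id : ℝ → ℝ)) (μ := gaussianReal 0 1)
    (by fun_prop) (by simp)
  rw [variance_id_gaussianReal] at h
  simpa using h.symm

/-- The variance of the square of a standard normal variable. -/
def chiSqVar : ℝ := ∫ x, (x ^ 2 - 1) ^ 2 ∂(gaussianReal 0 1)

lemma chiSqVar_nonneg : 0 ≤ chiSqVar := integral_nonneg fun _ => sq_nonneg _

lemma memLp_quadratic_gaussianReal (a b : ℝ) :
    MemLp (fun x : ℝ => a * (x ^ 2 - 1) + b * x) 2 (gaussianReal 0 1) :=
  ((memLp_sq_gaussianReal.sub (memLp_const 1)).const_mul a).add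
    ((memLp_id_gaussianReal' 2 (by simp)).const_mul b)

lemma integral_quadratic_gaussianReal (a b : ℝ) :
    ∫ x, (a * (x ^ 2 - 1) + b * x) ∂(gaussianReal 0 1) = 0 := by
  have h1 : Integrable (fun x : ℝ => x ^ 2) (gaussianReal 0 1) :=
    memLp_sq_gaussianReal.integrable (by norm_num)
  have h2 : Integrable (fun x : ℝ => x) (gaussianReal 0 1) :=
    (memLp_id_gaussianReal' 1 (by simp)).integrable (by norm_num)
  have h3 : Integrable (fun x : ℝ => x ^ 2 - 1) (gaussianReal 0 1) := h1.sub (integrable_const 1)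
  rw [integral_add (h3.const_mul a) (h2.const_mul b),
    integral_const_mul, integral_const_mul, integral_sub h1 (integrable_const 1),
    integral_sq_gaussianReal, integral_id_gaussianReal]
  simp

lemma variance_quadratic_gaussianReal_le (a b : ℝ) :
    Var[fun x : ℝ => a * (x ^ 2 - 1) + b * x; gaussianReal 0 1]
      ≤ 2 * chiSqVar * a ^ 2 + 2 * b ^ 2 := by
  have h1 : Integrable (fun x : ℝ => (x ^ 2 - 1) ^ 2) (gaussianReal 0 1) :=
    (memLp_sq_gaussianReal.sub (memLp_const 1)).integrable_sq
  have h2 : Integrable (fun x : ℝ => x ^ 2) (gaussianReal 0 1) :=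
    memLp_sq_gaussianReal.integrable (by norm_num)
  calc _ ≤ ∫ x, (a * (x ^ 2 - 1) + b * x) ^ 2 ∂(gaussianReal 0 1) :=
        variance_le_expectation_sq (by fun_prop)
    _ ≤ ∫ x, (2 * a ^ 2 * (x ^ 2 - 1) ^ 2 + 2 * b ^ 2 * x ^ 2) ∂(gaussianReal 0 1) := by
        refine integral_mono (memLp_quadratic_gaussianReal a b).integrable_sq
          ((h1.const_mul _).add (h2.const_mul _)) fun x => ?_
        nlinarith [sq_nonneg (a * (x ^ 2 - 1) - b * x)]
    _ = _ := by
        rw [integral_add (h1.const_mul _) (h2.const_mul _), integral_const_mul,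
          integral_const_mul, integral_sq_gaussianReal, chiSqVar]
        ring

variable {Ω : Type*} [MeasurableSpace Ω] {P : Measure Ω} [IsProbabilityMeasure P]
  {ι : Type*} [Fintype ι]

/-- Chebyshev's inequality for a quadratic polynomial in independent standard normal variables. -/
lemma chebyshev_quadratic {W : ι → Ω → ℝ} (hind : iIndepFun W P)
    (hW : ∀ i, AEMeasurable (W i) P) (hlaw : ∀ i, P.map (W i) = gaussianReal 0 1)
    (a b : ι → ℝ) {s : ℝ} (hs : 0 < s) :
    P {ω | s ≤ |∑ i, (a i * (W i ω ^ 2 - 1) + b i * W i ω)|} ≤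
      ENNReal.ofReal ((2 * chiSqVar * ∑ i, a i ^ 2 + 2 * ∑ i, b i ^ 2) / s ^ 2) := by
  set g : ι → ℝ → ℝ := fun i x => a i * (x ^ 2 - 1) + b i * x with hg
  have hgm : ∀ i, Measurable (g i) := fun i => by fun_prop
  set Z : ι → Ω → ℝ := fun i => g i ∘ W i with hZ
  have hZmem : ∀ i, MemLp (Z i) 2 P := fun i => by
    rw [hZ, ← memLp_map_measure_iff (hgm i).aestronglyMeasurable (hW i), hlaw]
    exact memLp_quadratic_gaussianReal _ _
  have hZmean : ∀ i, ∫ ω, Z i ω ∂P = 0 := fun i => by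
    have := integral_map (hW i) (f := g i) (hgm i).aestronglyMeasurable
    rw [hlaw, integral_quadratic_gaussianReal] at this
    exact this.symm
  have hZvar : ∀ i, Var[Z i; P] ≤ 2 * chiSqVar * a i ^ 2 + 2 * b i ^ 2 := fun i => by
    rw [hZ, ← variance_map (hgm i).aemeasurable (hW i), hlaw]
    exact variance_quadratic_gaussianReal_le _ _
  have hZind : iIndepFun Z P := hind.comp g hgm
  have hvar : Var[∑ i, Z i; P] ≤ 2 * chiSqVar * ∑ i, a i ^ 2 + 2 * ∑ i, b i ^ 2 := by
    rw [IndepFun.variance_sum (fun i _ => hZmem i) fun i _ j _ hij => hZind.indepFun hij,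
      Finset.mul_sum, Finset.mul_sum, ← Finset.sum_add_distrib]
    exact Finset.sum_le_sum fun i _ => hZvar i
  have hmean : ∫ ω, (∑ i, Z i) ω ∂P = 0 := by
    simp only [Finset.sum_apply]
    rw [integral_finsetSum _ fun i _ => (hZmem i).integrable (by norm_num)]
    simp [hZmean]
  have hch := meas_ge_le_variance_div_sq (memLp_finsetSum' Finset.univ fun i _ => hZmem i) hs
  rw [hmean] at hch
  simp only [sub_zero, Finset.sum_apply] at hch
  refine hch.trans (ENNReal.ofReal_le_ofReal ?_)
  gcongr

/-- The linear image of a Gaussian vector that has unit covariance is a vector of independent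
standard normal variables. -/
lemma standardize [DecidableEq ι] {Z : ι → Ω → ℝ} (hZ : HasGaussianLaw (fun ω i => Z i ω) P)
    {A U : Matrix ι ι ℝ} (hcov : ∀ i j, cov[Z i, Z j; P] = A i j) (hU : U * A * Uᵀ = 1)
    {m : ι → ℝ} (hm : ∀ i, ∫ ω, Z i ω ∂P = m i) :
    iIndepFun (fun i ω => (U *ᵥ fun j => Z j ω - m j) i) P ∧
      (∀ i, AEMeasurable (fun ω => (U *ᵥ fun j => Z j ω - m j) i) P) ∧
      ∀ i, P.map (fun ω => (U *ᵥ fun j => Z j ω - m j) i) = gaussianReal 0 1 := by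
  have hZi : ∀ i, HasGaussianLaw (Z i) P := fun i => hZ.eval i
  have hZ2 : ∀ i, MemLp (Z i) 2 P := fun i => (hZi i).memLp_two
  set V : ι → Ω → ℝ := fun i ω => (U *ᵥ fun j => Z j ω) i with hV
  have hVg : HasGaussianLaw (fun ω i => V i ω) P :=
    hZ.map (LinearMap.toContinuousLinearMap (Matrix.mulVecLin U))
  have hVi : ∀ i, HasGaussianLaw (V i) P := fun i => hVg.eval i
  have hVcov : ∀ i j, cov[V i, V j; P] = (1 : Matrix ι ι ℝ) i j := fun i j => by
    have h1 : ∀ i, V i = fun ω => ∑ k, U i k * Z k ω := fun i => rfl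
    rw [h1, h1, covariance_fun_sum_fun_sum (fun k => (hZ2 k).const_mul _)
      (fun k => (hZ2 k).const_mul _), ← hU]
    simp only [covariance_const_mul_left, covariance_const_mul_right, hcov, mul_apply,
      transpose_apply, Finset.sum_mul]
    rw [Finset.sum_comm]
    exact Finset.sum_congr rfl fun k _ => Finset.sum_congr rfl fun l _ => by ring
  -- Jointly Gaussian variables that are uncorrelated are independent.
  have hVind : iIndepFun V P := hVg.iIndepFun_of_covariance_eq_zero fun i j hij => by
    rw [hVcov, one_apply_ne hij]
  have hVmean : ∀ i, ∫ ω, V i ω ∂P = (U *ᵥ m) i := fun i => by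
    simp only [hV, mulVec, dotProduct]
    rw [integral_finsetSum _ fun k _ => ((hZ2 k).integrable (by norm_num)).const_mul _]
    simp only [integral_const_mul, hm]
  have hWV : ∀ i, (fun ω => (U *ᵥ fun j => Z j ω - m j) i) = (fun x => x - (U *ᵥ m) i) ∘ V i := by
    intro i; funext ω
    have : (fun j => Z j ω - m j) = (fun j => Z j ω) - m := rfl
    simp only [this, mulVec_sub, Pi.sub_apply, Function.comp, hV]
  refine ⟨?_, fun i => ?_, fun i => ?_⟩
  · rw [funext hWV]
    exact hVind.comp _ fun i => by fun_prop
  · rw [hWV]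
    exact (by fun_prop : Measurable fun x : ℝ => x - (U *ᵥ m) i).comp_aemeasurable
      (hVi i).aemeasurable
  · rw [hWV, ← AEMeasurable.map_map_of_aemeasurable (by fun_prop) (hVi i).aemeasurable,
      (hVi i).map_eq_gaussianReal, gaussianReal_map_sub_const, hVmean, sub_self,
      ← covariance_self (hVi i).aemeasurable, hVcov, one_apply_eq, Real.toNNReal_one]

end Gaussian

/-! ### Events whose probability tends to one. -/

section HighProbability

variable {Ω : Type*} [MeasurableSpace Ω] {P : Measure Ω}

/-- The events `G N` have probability tending to one: their complements have (outer) measure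
tending to zero. -/
def Whp (P : Measure Ω) (G : ℕ → Ω → Prop) : Prop :=
  Tendsto (fun N => P {ω | ¬ G N ω}) atTop (𝓝 0)

lemma Whp.mono {G H : ℕ → Ω → Prop} (hG : Whp P G)
    (h : ∀ᶠ N in atTop, ∀ ω, G N ω → H N ω) : Whp P H := by
  refine tendsto_of_tendsto_of_tendsto_of_le_of_le' tendsto_const_nhds hG
    (Eventually.of_forall fun _ => zero_le) ?_
  filter_upwards [h] with N hN
  exact measure_mono fun ω hω hG => hω (hN ω hG)

lemma Whp.and {G H : ℕ → Ω → Prop} (hG : Whp P G) (hH : Whp P H) :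
    Whp P fun N ω => G N ω ∧ H N ω := by
  have h := hG.add hH
  rw [add_zero] at h
  refine tendsto_of_tendsto_of_tendsto_of_le_of_le tendsto_const_nhds h
    (fun _ => zero_le) fun N => ?_
  refine (measure_mono fun ω hω => ?_).trans (measure_union_le _ _)
  simpa only [Set.mem_union, Set.mem_ofPred_eq, ← not_and_or] using hω

/-- This is the rate that Chebyshev yields: variance of order `N²` against a squared threshold of
order `N⁴`. -/
lemma Whp.of_le_div_sq {G : ℕ → Ω → Prop} {K : ℝ}
    (h : ∀ᶠ N : ℕ in atTop, P {ω | ¬ G N ω} ≤ ENNReal.ofReal (K / (N : ℝ) ^ 2)) : Whp P G := by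
  have h1 : Tendsto (fun N : ℕ => ENNReal.ofReal (K / (N : ℝ) ^ 2)) atTop (𝓝 0) := by
    rw [← ENNReal.ofReal_zero]
    refine ENNReal.tendsto_ofReal ?_
    exact tendsto_const_nhds.div_atTop
      ((tendsto_pow_atTop two_ne_zero).comp tendsto_natCast_atTop_atTop)
  exact tendsto_of_tendsto_of_tendsto_of_le_of_le' tendsto_const_nhds h1
    (Eventually.of_forall fun _ => zero_le) h

lemma tendstoInMeasure_of_whp {E' : Type*} [NormedAddCommGroup E'] {f : ℕ → Ω → E'} {a : E'}
    (h : ∀ ε : ℝ, 0 < ε → Whp P fun N ω => ‖f N ω - a‖ < ε) :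
    TendstoInMeasure P f atTop fun _ => a := by
  rw [tendstoInMeasure_iff_norm]
  intro ε hε
  simpa only [Whp, not_lt] using h ε hε

end HighProbability

/-! ### The observed field and its standardised residuals. -/

section Data

open Matrix

/-- The Gaussian field `Y` has the mean `∑ β₀ l X l` and the spectrum `F₀`. -/
structure DataModel {Ω : Type*} [MeasurableSpace Ω] (P : Measure Ω) {L : ℕ} (F₀ : ℝ × ℝ → ℝ)
    (X : Fin L → ℤ × ℤ → ℝ) (β₀ : EuclideanSpace ℝ (Fin L)) (Y : ℤ × ℤ → Ω → ℝ) : Prop where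
  gauss : IsGaussianProcess Y P
  mean : ∀ t, ∫ ω, Y t ω ∂P = ∑ l, β₀ l * X l t
  cov : ∀ s t, cov[Y s, Y t; P] = acf F₀ (t - s)

variable {Ω : Type*} [MeasurableSpace Ω] {P : Measure Ω} [IsProbabilityMeasure P] {L : ℕ}
  {F₀ : ℝ × ℝ → ℝ} {X : Fin L → ℤ × ℤ → ℝ} {β₀ : EuclideanSpace ℝ (Fin L)}
  {Y : ℤ × ℤ → Ω → ℝ}

lemma DataModel.standardize (h : DataModel P F₀ X β₀ Y) (hF : IntegrableOn F₀ freqBox) {N : ℕ}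
    {U : Matrix (Fin N × Fin N) (Fin N × Fin N) ℝ} (hU : U * covMat N F₀ * Uᵀ = 1) :
    iIndepFun (fun i ω => (U *ᵥ residual X N (fun t => Y t ω) β₀) i) P ∧
      (∀ i, AEMeasurable (fun ω => (U *ᵥ residual X N (fun t => Y t ω) β₀) i) P) ∧
      ∀ i, P.map (fun ω => (U *ᵥ residual X N (fun t => Y t ω) β₀) i) = gaussianReal 0 1 := by
  -- Finite-dimensional laws of a Gaussian process are indexed by a finset; `l` reindexes the one
  -- over `Finset.univ` by the type itself.
  let l : (↥(Finset.univ : Finset (Fin N × Fin N)) → ℝ) →L[ℝ] (Fin N × Fin N → ℝ) :=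
    ContinuousLinearMap.pi fun i =>
      ContinuousLinearMap.proj (R := ℝ) (φ := fun _ => ℝ) ⟨i, Finset.mem_univ i⟩
  have hg : HasGaussianLaw (fun ω (i : Fin N × Fin N) => Y (site i) ω) P :=
    ((h.gauss.comp_right (site (N := N))).hasGaussianLaw Finset.univ).map l
  refine LatticeField.standardize hg (A := covMat N F₀) (fun i j => ?_) hU
    (m := (regMat N X) *ᵥ (fun l => β₀ l)) fun i => ?_
  · rw [h.cov, covMat, of_apply, ← acf_neg hF, neg_sub]
  · rw [h.mean]
    simp only [mulVec, dotProduct, regMat, of_apply]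
    exact Finset.sum_congr rfl fun l _ => mul_comm _ _

/-- The law of large numbers for quadratic polynomials in the standardised residuals. -/
lemma DataModel.whp_quadratic (h : DataModel P F₀ X β₀ Y) (hF : IntegrableOn F₀ freqBox)
    {U : ∀ N : ℕ, Matrix (Fin N × Fin N) (Fin N × Fin N) ℝ}
    (hU : ∀ N, U N * covMat N F₀ * (U N)ᵀ = 1) {a b : ∀ N : ℕ, Fin N × Fin N → ℝ} {K : ℝ}
    (ha : ∀ᶠ N : ℕ in atTop, ∑ i, a N i ^ 2 ≤ K * (N : ℝ) ^ 2)
    (hb : ∀ᶠ N : ℕ in atTop, ∑ i, b N i ^ 2 ≤ K * (N : ℝ) ^ 2) {δ : ℝ} (hδ : 0 < δ) :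
    Whp P fun N ω => |∑ i, (a N i * ((U N *ᵥ residual X N (fun t => Y t ω) β₀) i ^ 2 - 1)
      + b N i * (U N *ᵥ residual X N (fun t => Y t ω) β₀) i)| ≤ δ * (N : ℝ) ^ 2 := by
  refine Whp.of_le_div_sq (K := (2 * chiSqVar * K + 2 * K) / δ ^ 2) ?_
  filter_upwards [ha, hb, eventually_gt_atTop 0] with N haN hbN hN
  have hN' : (0 : ℝ) < N := by exact_mod_cast hN
  obtain ⟨h1, h2, h3⟩ := h.standardize hF (hU N)
  have h4 := chebyshev_quadratic h1 h2 h3 (a N) (b N) (s := δ * (N : ℝ) ^ 2) (by positivity)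
  refine (measure_mono fun ω hω => ?_).trans (h4.trans (ENNReal.ofReal_le_ofReal ?_))
  · exact (not_le.1 hω).le
  · have h5 := mul_le_mul_of_nonneg_left haN (mul_nonneg zero_le_two chiSqVar_nonneg)
    rw [div_div, div_le_div_iff₀ (by positivity) (by positivity)]
    have h6 : 2 * chiSqVar * ∑ i, a N i ^ 2 + 2 * ∑ i, b N i ^ 2
        ≤ (2 * chiSqVar * K + 2 * K) * (N : ℝ) ^ 2 := by linarith
    calc _ ≤ (2 * chiSqVar * K + 2 * K) * (N : ℝ) ^ 2 * (δ ^ 2 * (N : ℝ) ^ 2) := by gcongr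
      _ = _ := by ring

end Data

/-! ### The log likelihood ratio in diagonalising coordinates. -/

section Likelihood

open Matrix

/-- Inversion reverses the order of forms; diagonalising `A` against the identity reduces this to
scalars. -/
lemma quad_inv_le {ι : Type*} [Fintype ι] [DecidableEq ι] {A : Matrix ι ι ℝ} (hA : A.PosDef)
    {k : ℝ} (hk : ∀ v : ι → ℝ, v ⬝ᵥ v ≤ k * (v ⬝ᵥ (A *ᵥ v))) (x : ι → ℝ) :
    x ⬝ᵥ (A⁻¹ *ᵥ x) ≤ k * (x ⬝ᵥ x) := by
  obtain ⟨T, U, e, h⟩ := exists_simDiag hA PosDef.one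
  have he := h.eigen_le (k := k) (by simpa using hk)
  have h1 := h.quad_inv_right x
  rw [inv_one, one_mulVec] at h1
  rw [h1, h.quad_inv_left, Finset.mul_sum]
  refine Finset.sum_le_sum fun i _ => ?_
  rw [← mul_assoc]
  refine le_mul_of_one_le_left (sq_nonneg _) ?_
  rw [← div_eq_mul_inv, one_le_div (h.pos i)]
  exact he i

lemma le_quad_inv {ι : Type*} [Fintype ι] [DecidableEq ι] {A : Matrix ι ι ℝ} (hA : A.PosDef)
    {k : ℝ} (hk : ∀ v : ι → ℝ, v ⬝ᵥ (A *ᵥ v) ≤ k * (v ⬝ᵥ v)) (x : ι → ℝ) :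
    x ⬝ᵥ x ≤ k * (x ⬝ᵥ (A⁻¹ *ᵥ x)) := by
  obtain ⟨T, U, e, h⟩ := exists_simDiag hA PosDef.one
  have he := h.inv_eigen_le (k := k) (by simpa using hk)
  have h1 := h.quad_inv_right x
  rw [inv_one, one_mulVec] at h1
  rw [h1, h.quad_inv_left, Finset.mul_sum]
  exact Finset.sum_le_sum fun i _ => mul_le_mul_of_nonneg_right (he i) (sq_nonneg _)

variable {p L : ℕ} {F : EuclideanSpace ℝ (Fin p) → ℝ × ℝ → ℝ} {X : Fin L → ℤ × ℤ → ℝ}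

lemma residual_eq_add (X : Fin L → ℤ × ℤ → ℝ) (N : ℕ) (y : ℤ × ℤ → ℝ)
    (β β' : EuclideanSpace ℝ (Fin L)) :
    residual X N y β = residual X N y β' + regMat N X *ᵥ (fun l => (β' - β) l) := by
  have : (fun l => (β' - β) l) = (fun l => β' l) - fun l => β l := rfl
  simp only [residual, this, mulVec_sub]
  abel

/-- The log likelihood ratio in coordinates that diagonalise both covariance matrices. -/
lemma logLik_sub_eq {N : ℕ} {θ θ' : EuclideanSpace ℝ (Fin p)}
    {T U : Matrix (Fin N × Fin N) (Fin N × Fin N) ℝ} {e : Fin N × Fin N → ℝ}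
    (h : SimDiag (covMat N (F θ)) (covMat N (F θ')) T U e) (y : ℤ × ℤ → ℝ)
    (β β' : EuclideanSpace ℝ (Fin L)) :
    logLik F X N y θ' β' - logLik F X N y θ β =
      ∑ i, (1 / 2 * Real.log (e i)⁻¹ - 1 / 2 * ((e i)⁻¹ * (U *ᵥ residual X N y β') i ^ 2)
        + 1 / 2 * (U *ᵥ residual X N y β) i ^ 2) := by
  rw [logLik, logLik, h.log_det, h.quad_inv_left, h.quad_inv_right]
  simp only [Real.log_inv, Finset.sum_add_distrib, Finset.sum_sub_distrib, ← Finset.mul_sum,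
    Finset.sum_neg_distrib]
  ring

/-- With `(θ, β)` the truth, the coordinates of `U *ᵥ residual X N y β` are independent standard
normals. The first two terms are then the mean of the log ratio, and the last sum is centred noise.
-/
lemma logLik_sub_eq_centered {N : ℕ} {θ θ' : EuclideanSpace ℝ (Fin p)}
    {T U : Matrix (Fin N × Fin N) (Fin N × Fin N) ℝ} {e : Fin N × Fin N → ℝ}
    (h : SimDiag (covMat N (F θ)) (covMat N (F θ')) T U e) (y : ℤ × ℤ → ℝ)
    (β β' : EuclideanSpace ℝ (Fin L)) :
    logLik F X N y θ' β' - logLik F X N y θ β =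
      1 / 2 * ∑ i, (Real.log (e i)⁻¹ + 1 - (e i)⁻¹)
      - 1 / 2 * ((regMat N X *ᵥ (fun l => (β - β') l)) ⬝ᵥ
          ((covMat N (F θ'))⁻¹ *ᵥ (regMat N X *ᵥ (fun l => (β - β') l))))
      - ∑ i, (1 / 2 * ((e i)⁻¹ - 1) * ((U *ᵥ residual X N y β) i ^ 2 - 1)
        + (e i)⁻¹ * (U *ᵥ (regMat N X *ᵥ (fun l => (β - β') l))) i
          * (U *ᵥ residual X N y β) i) := by
  rw [logLik_sub_eq h, h.quad_inv_right, Finset.mul_sum, Finset.mul_sum,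
    ← Finset.sum_sub_distrib, ← Finset.sum_sub_distrib]
  refine Finset.sum_congr rfl fun i _ => ?_
  rw [residual_eq_add X N y β' β, mulVec_add, Pi.add_apply]
  ring

/-- Applying `log u ≤ u - 1` at `u = √x` bounds the left side by `-(√x - 1)²`, and `(√x + 1)² ≤ 2 (R
+ 1)` converts this into `(x - 1)²`. -/
lemma log_add_one_sub_le {x R : ℝ} (hx : 0 < x) (hxR : x ≤ R) :
    Real.log x + 1 - x ≤ -((x - 1) ^ 2 / (2 * (R + 1))) := by
  have h0 : 0 < √x := Real.sqrt_pos.2 hx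
  have h1 : √x ^ 2 = x := Real.sq_sqrt hx.le
  have h2 : Real.log x = 2 * Real.log √x := by rw [Real.log_sqrt hx.le]; ring
  have h3 := Real.log_le_sub_one_of_pos h0
  have h4 : (x - 1) ^ 2 / (2 * (R + 1)) ≤ (√x - 1) ^ 2 := by
    rw [div_le_iff₀ (by linarith)]
    have h5 : (x - 1) ^ 2 = (√x - 1) ^ 2 * (√x + 1) ^ 2 := by
      rw [← mul_pow]; congr 1; linarith
    rw [h5]
    refine mul_le_mul_of_nonneg_left ?_ (sq_nonneg _)
    nlinarith [sq_nonneg (√x - 1)]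
  nlinarith

end Likelihood

/-! ### The likelihood gap at a fixed wrong parameter. -/

section Separation

open Matrix

variable {p L : ℕ} {Θ : Set (EuclideanSpace ℝ (Fin p))}
  {F : EuclideanSpace ℝ (Fin p) → ℝ × ℝ → ℝ} {X : Fin L → ℤ × ℤ → ℝ}

lemma RegularSpectra.integrableOn (h : RegularSpectra Θ F) {θ : EuclideanSpace ℝ (Fin p)}
    (hθ : θ ∈ Θ) : IntegrableOn (F θ) freqBox := by
  refine ContinuousOn.integrableOn_compact isCompact_freqBox ?_
  exact h.continuousOn.comp (f := fun w => (θ, w)) (by fun_prop) fun w hw => ⟨hθ, hw⟩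

lemma zero_mem_freqBox : (0 : ℝ × ℝ) ∈ freqBox := by
  have := Real.pi_pos.le
  exact ⟨⟨neg_nonpos.2 this, this⟩, ⟨neg_nonpos.2 this, this⟩⟩

/-- The generalised least squares form `v' X' Σ⁻¹ X v` of the regression. -/
def regQuad (X : Fin L → ℤ × ℤ → ℝ) (N : ℕ) (G : ℝ × ℝ → ℝ) (v : Fin L → ℝ) : ℝ :=
  (regMat N X *ᵥ v) ⬝ᵥ ((covMat N G)⁻¹ *ᵥ (regMat N X *ᵥ v))

lemma regQuad_eq (X : Fin L → ℤ × ℤ → ℝ) {N : ℕ} (hN : 0 < N) (G : ℝ × ℝ → ℝ)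
    (v : Fin L → ℝ) :
    regQuad X N G v = (N : ℝ) ^ 2 * (v ⬝ᵥ ((((N : ℝ) ^ 2)⁻¹ •
      ((regMat N X)ᵀ * (covMat N G)⁻¹ * regMat N X)) *ᵥ v)) := by
  have hN' : (N : ℝ) ^ 2 ≠ 0 := by positivity
  rw [smul_mulVec, dotProduct_smul, smul_eq_mul, mul_inv_cancel_left₀ hN', Matrix.mul_assoc,
    ← mulVec_mulVec, ← mulVec_mulVec, dotProduct_mulVec v, vecMul_transpose, regQuad]

lemma tendsto_regQuad {G : ℝ × ℝ → ℝ} {M : Matrix (Fin L) (Fin L) ℝ}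
    (h : Tendsto (fun N : ℕ => ((N : ℝ) ^ 2)⁻¹ •
      ((regMat N X)ᵀ * (covMat N G)⁻¹ * regMat N X)) atTop (𝓝 M)) (v : Fin L → ℝ) :
    Tendsto (fun N : ℕ => regQuad X N G v / (N : ℝ) ^ 2) atTop (𝓝 (v ⬝ᵥ (M *ᵥ v))) := by
  have hc : Continuous fun A : Matrix (Fin L) (Fin L) ℝ => v ⬝ᵥ (A *ᵥ v) := by fun_prop
  refine ((hc.tendsto M).comp h).congr' ?_
  filter_upwards [eventually_gt_atTop 0] with N hN
  have hN' : (N : ℝ) ^ 2 ≠ 0 := by positivity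
  rw [regQuad_eq X hN, Function.comp, mul_div_cancel_left₀ _ hN']

/-- Distinct spectra have covariance matrices at a squared Frobenius distance of order `N²`. -/
lemma exists_frobenius_ge {G G' : ℝ × ℝ → ℝ} {t : ℤ × ℤ} (ht : acf G t ≠ acf G' t) :
    ∃ d > 0, ∀ᶠ N : ℕ in atTop,
      d * (N : ℝ) ^ 2 ≤ ∑ i, ∑ j, (covMat N G i j - covMat N G' i j) ^ 2 := by
  refine ⟨(acf G t - acf G' t) ^ 2 / 4, by
    have := sub_ne_zero.2 ht
    positivity, ?_⟩
  -- For such `N` each coordinate retains at least `N / 2` pairs, whence the factor 1/4 in the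
  -- witness.
  filter_upwards [eventually_ge_atTop (2 * (t.1.natAbs + t.2.natAbs))] with N hN
  refine le_trans ?_ (frobenius_covMat_sub_ge G G' t N)
  have h1 : (N : ℝ) / 2 ≤ ((N - t.1.natAbs : ℕ) : ℝ) := by
    rw [div_le_iff₀ two_pos]; norm_cast; omega
  have h2 : (N : ℝ) / 2 ≤ ((N - t.2.natAbs : ℕ) : ℝ) := by
    rw [div_le_iff₀ two_pos]; norm_cast; omega
  calc _ = ((N : ℝ) / 2 * (N / 2)) * (acf G t - acf G' t) ^ 2 := by ring
    _ ≤ _ := by gcongr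

/-- The expected log likelihood ratio is at most `-δ N²`, when the spectra are distinct. -/
lemma exists_entropy_ge {G G' : ℝ × ℝ → ℝ} (hG : IntegrableOn G freqBox)
    (hG' : IntegrableOn G' freqBox) {c C : ℝ} (hc : 0 < c)
    (hb : ∀ w ∈ freqBox, c ≤ G w ∧ G w ≤ C) (hb' : ∀ w ∈ freqBox, c ≤ G' w ∧ G' w ≤ C)
    {t : ℤ × ℤ} (ht : acf G t ≠ acf G' t) :
    ∃ δ > 0, ∀ᶠ N : ℕ in atTop, ∀ T U e, SimDiag (covMat N G) (covMat N G') T U e →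
      ∑ i, (Real.log (e i)⁻¹ + 1 - (e i)⁻¹) ≤ -(δ * (N : ℝ) ^ 2) := by
  obtain ⟨d, hd, hN⟩ := exists_frobenius_ge ht
  have hC : 0 < C := hc.trans_le ((hb 0 zero_mem_freqBox).1.trans (hb 0 zero_mem_freqBox).2)
  set R := C / c with hR
  have hRpos : 0 < R := div_pos hC hc
  have hcmp : ∀ {H H' : ℝ × ℝ → ℝ}, (∀ w ∈ freqBox, c ≤ H w ∧ H w ≤ C) →
      (∀ w ∈ freqBox, c ≤ H' w ∧ H' w ≤ C) → ∀ w ∈ freqBox, H w ≤ R * H' w := by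
    intro H H' h h' w hw
    calc H w ≤ C := (h w hw).2
      _ = R * c := by rw [hR]; field_simp
      _ ≤ R * H' w := by gcongr; exact (h' w hw).1
  -- `C ^ 2` comes from the Frobenius bound, `R ^ 2` from passing from `e` to its inverse, and `2 *
  -- (R + 1)` from the logarithmic inequality.
  refine ⟨d / (C ^ 2 * R ^ 2 * (2 * (R + 1))), by positivity, ?_⟩
  filter_upwards [hN] with N hdN T U e h
  have h1 := hdN.trans (h.frobenius_sub_le hC.le
    (quad_covMat_le_const hG (fun w hw => (hb w hw).2) N))
  have he : ∀ i, e i ≤ R := h.eigen_le (quad_covMat_le hG' hG (hcmp hb' hb) N)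
  have he' : ∀ i, (e i)⁻¹ ≤ R := h.inv_eigen_le (quad_covMat_le hG hG' (hcmp hb hb') N)
  have h2 : ∑ i, (e i - 1) ^ 2 ≤ R ^ 2 * ∑ i, ((e i)⁻¹ - 1) ^ 2 := by
    rw [Finset.mul_sum]
    refine Finset.sum_le_sum fun i _ => ?_
    have hei := (h.pos i).ne'
    have h3 : (e i - 1) ^ 2 = e i ^ 2 * ((e i)⁻¹ - 1) ^ 2 := by field_simp; ring
    rw [h3]
    have := (h.pos i).le
    have := he i
    gcongr
  have h4 : ∑ i, (Real.log (e i)⁻¹ + 1 - (e i)⁻¹)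
      ≤ -((∑ i, ((e i)⁻¹ - 1) ^ 2) / (2 * (R + 1))) := by
    rw [Finset.sum_div, ← Finset.sum_neg_distrib]
    exact Finset.sum_le_sum fun i _ => log_add_one_sub_le (inv_pos.2 (h.pos i)) (he' i)
  refine h4.trans (neg_le_neg ?_)
  rw [div_mul_eq_mul_div, ← div_div, div_le_div_iff_of_pos_right (by positivity),
    div_le_iff₀ (by positivity)]
  calc d * (N : ℝ) ^ 2 ≤ C ^ 2 * ∑ i, (e i - 1) ^ 2 := h1
    _ ≤ C ^ 2 * (R ^ 2 * ∑ i, ((e i)⁻¹ - 1) ^ 2) := by gcongr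
    _ = _ := by ring

variable {Ω : Type*} [MeasurableSpace Ω] {P : Measure Ω} [IsProbabilityMeasure P]
  {β₀ : EuclideanSpace ℝ (Fin L)} {Y : ℤ × ℤ → Ω → ℝ} {θ₀ : EuclideanSpace ℝ (Fin p)}
  {M : EuclideanSpace ℝ (Fin p) → Matrix (Fin L) (Fin L) ℝ}

/-- At a fixed wrong parameter the log likelihood falls short of its value at the truth by a
multiple of `N²`, with high probability. -/
lemma whp_logLik_le (hA : RegularSpectra Θ F) (hid : Identifiable Θ F) (hθ₀ : θ₀ ∈ Θ)
    (hY : DataModel P (F θ₀) X β₀ Y)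
    (hlim : ∀ θ ∈ Θ, Tendsto (fun N : ℕ => ((N : ℝ) ^ 2)⁻¹ •
        ((regMat N X)ᵀ * (covMat N (F θ))⁻¹ * regMat N X)) atTop (𝓝 (M θ)))
    (hpos : ∀ θ ∈ Θ, (M θ).PosDef) {θ : EuclideanSpace ℝ (Fin p)} (hθ : θ ∈ Θ)
    {β : EuclideanSpace ℝ (Fin L)} (hne : (θ, β) ≠ (θ₀, β₀)) :
    ∃ δ > 0, Whp P fun N ω => logLik F X N (fun t => Y t ω) θ β
      ≤ logLik F X N (fun t => Y t ω) θ₀ β₀ - δ * (N : ℝ) ^ 2 := by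
  obtain ⟨c, C, hc, hb⟩ := hA.bounded
  have hi₀ := hA.integrableOn hθ₀
  have hi := hA.integrableOn hθ
  have hC : 0 < C := hc.trans_le ((hb θ₀ hθ₀ 0 zero_mem_freqBox).1.trans
    (hb θ₀ hθ₀ 0 zero_mem_freqBox).2)
  set v : Fin L → ℝ := fun l => (β₀ - β) l with hv
  have hpd : ∀ {θ}, θ ∈ Θ → ∀ N, (covMat N (F θ)).PosDef := fun {θ} hθ N =>
    posDef_covMat (hA.integrableOn hθ) hc (fun w hw => (hb θ hθ w hw).1) N
  have hq := tendsto_regQuad (hlim θ hθ) v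
  have hq0 : ∀ N, 0 ≤ regQuad X N (F θ) v := fun N => by
    have := (hpd hθ N).inv.posSemidef.dotProduct_mulVec_nonneg (regMat N X *ᵥ v)
    simpa [regQuad] using this
  have hent0 : ∀ N T U e, SimDiag (covMat N (F θ₀)) (covMat N (F θ)) T U e →
      ∑ i, (Real.log (e i)⁻¹ + 1 - (e i)⁻¹) ≤ 0 := fun N T U e h =>
    Finset.sum_nonpos fun i _ => by
      linarith [Real.log_le_sub_one_of_pos (inv_pos.2 (h.pos i))]
  -- The regression form supplies the gap when `θ = θ₀`, the entropy otherwise; the other term has a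
  -- favourable sign. Of the `2 * δ`, one `δ` is reserved for the noise.
  have hdrift : ∃ δ > 0, ∀ᶠ N : ℕ in atTop, ∀ T U e,
      SimDiag (covMat N (F θ₀)) (covMat N (F θ)) T U e →
      1 / 2 * ∑ i, (Real.log (e i)⁻¹ + 1 - (e i)⁻¹) - 1 / 2 * regQuad X N (F θ) v
        ≤ -(2 * δ * (N : ℝ) ^ 2) := by
    by_cases hθθ : θ = θ₀
    · have hβ : v ≠ 0 := by
        intro h0
        refine hne (Prod.ext hθθ ?_)
        refine (sub_eq_zero.1 ?_ : β₀ = β).symm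
        ext l
        exact congrFun h0 l
      have hm : 0 < v ⬝ᵥ (M θ *ᵥ v) := by
        simpa using (hpos θ hθ).dotProduct_mulVec_pos hβ
      set m := v ⬝ᵥ (M θ *ᵥ v)
      refine ⟨m / 8, by positivity, ?_⟩
      filter_upwards [hq.eventually_const_le (half_lt_self hm), eventually_gt_atTop 0]
        with N hN hN0 T U e h
      have hN' : (0 : ℝ) < (N : ℝ) ^ 2 := by positivity
      rw [le_div_iff₀ hN'] at hN
      linarith [hent0 N T U e h]
    · obtain ⟨t, ht⟩ := exists_acf_ne (hA.admissible θ₀ hθ₀).summable (hA.admissible θ hθ).summable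
        fun h => hθθ (hid θ₀ hθ₀ θ hθ h).symm
      obtain ⟨δ, hδ, hN⟩ := exists_entropy_ge hi₀ hi hc (hb θ₀ hθ₀) (hb θ hθ) ht
      refine ⟨δ / 4, by positivity, ?_⟩
      filter_upwards [hN] with N hN T U e h
      linarith [hN T U e h, hq0 N]
  obtain ⟨δ, hδ, hdr⟩ := hdrift
  refine ⟨δ, hδ, ?_⟩
  choose T U e hSD using fun N => exists_simDiag (hpd hθ₀ N) (hpd hθ N)
  set R := C / c with hR
  have hRpos : 0 < R := div_pos hC hc
  have he : ∀ N i, (e N i)⁻¹ ≤ R := fun N => (hSD N).inv_eigen_le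
    (quad_covMat_le hi₀ hi (fun w hw => by
      calc F θ₀ w ≤ C := (hb θ₀ hθ₀ w hw).2
        _ = R * c := by rw [hR]; field_simp
        _ ≤ R * F θ w := by gcongr; exact (hb θ hθ w hw).1) N)
  set m := v ⬝ᵥ (M θ *ᵥ v)
  have hwhp := hY.whp_quadratic hi₀ (U := U) (fun N => (hSD N).conj_left)
    (a := fun N i => 1 / 2 * ((e N i)⁻¹ - 1))
    (b := fun N i => (e N i)⁻¹ * (U N *ᵥ (regMat N X *ᵥ v)) i)
    -- The first bound serves the quadratic coefficients. For the linear ones, one factor `(e N i)⁻¹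
    -- ≤ R` is pulled out and the rest sums to `regQuad`, eventually at most `(m + 1) N²`.
    (K := max ((R + 1) ^ 2) (R * (m + 1))) ?_ ?_ hδ
  · refine hwhp.mono ?_
    filter_upwards [hdr] with N hN ω hω
    have h1 := logLik_sub_eq_centered (X := X) (hSD N) (fun t => Y t ω) β₀ β
    have h2 := hN _ _ _ (hSD N)
    have h3 := (abs_le.1 hω).1
    simp only [regQuad, hv] at h2 h3
    linarith
  · refine Eventually.of_forall fun N => ?_
    have h1 : ∀ i ∈ Finset.univ, (1 / 2 * ((e N i)⁻¹ - 1)) ^ 2 ≤ (R + 1) ^ 2 := fun i _ => by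
      have h2 := he N i
      have h3 := inv_pos.2 ((hSD N).pos i)
      refine sq_le_sq' ?_ ?_ <;> linarith
    have h4 := Finset.sum_le_card_nsmul _ _ _ h1
    simp only [Finset.card_univ, Fintype.card_prod, Fintype.card_fin, nsmul_eq_mul,
      Nat.cast_mul] at h4
    calc _ ≤ (N : ℝ) * N * (R + 1) ^ 2 := h4
      _ = (R + 1) ^ 2 * (N : ℝ) ^ 2 := by ring
      _ ≤ _ := by gcongr; exact le_max_left _ _
  · filter_upwards [hq.eventually_le_const (lt_add_one m), eventually_gt_atTop 0] with N hN hN0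
    have hN' : (0 : ℝ) < (N : ℝ) ^ 2 := by positivity
    rw [div_le_iff₀ hN'] at hN
    have h1 : regQuad X N (F θ) v = _ := (hSD N).quad_inv_right (regMat N X *ᵥ v)
    calc _ ≤ R * regQuad X N (F θ) v := by
          rw [h1, Finset.mul_sum]
          refine Finset.sum_le_sum fun i _ => ?_
          have h3 := inv_pos.2 ((hSD N).pos i)
          rw [mul_pow, sq (e N i)⁻¹, mul_assoc]
          exact mul_le_mul_of_nonneg_right (he N i) (by positivity)
      _ ≤ R * ((m + 1) * (N : ℝ) ^ 2) := by gcongr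
      _ = R * (m + 1) * (N : ℝ) ^ 2 := by ring
      _ ≤ _ := by gcongr; exact le_max_right _ _

end Separation

/-! ### Equicontinuity of the normalised log likelihood. -/

section Uniformity

open Matrix

variable {p L : ℕ} {Θ : Set (EuclideanSpace ℝ (Fin p))} {B : Set (EuclideanSpace ℝ (Fin L))}
  {F : EuclideanSpace ℝ (Fin p) → ℝ × ℝ → ℝ} {X : Fin L → ℤ × ℤ → ℝ}

/-- A crude bound, but its constant is continuous in `A`, so convergence of matrices gives a bound
uniform in `v`. -/
lemma quad_le_sum_abs {ι : Type*} [Fintype ι] (A : Matrix ι ι ℝ) (v : ι → ℝ) :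
    v ⬝ᵥ (A *ᵥ v) ≤ (∑ i, ∑ j, |A i j|) * (v ⬝ᵥ v) := by
  have hv : ∀ i, v i ^ 2 ≤ v ⬝ᵥ v := fun i => by
    simp only [dotProduct, ← sq]
    exact Finset.single_le_sum (f := fun i => v i ^ 2) (fun i _ => sq_nonneg _)
      (Finset.mem_univ i)
  rw [Finset.sum_mul]
  simp only [Finset.sum_mul]
  rw [dotProduct]
  refine Finset.sum_le_sum fun i _ => ?_
  rw [mulVec, dotProduct, Finset.mul_sum]
  refine Finset.sum_le_sum fun j _ => ?_
  have h1 : |v i * v j| ≤ v ⬝ᵥ v := by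
    rw [abs_le]
    constructor <;> nlinarith [hv i, hv j, sq_nonneg (v i + v j), sq_nonneg (v i - v j)]
  calc v i * (A i j * v j) = A i j * (v i * v j) := by ring
    _ ≤ |A i j * (v i * v j)| := le_abs_self _
    _ = |A i j| * |v i * v j| := abs_mul _ _
    _ ≤ _ := by gcongr

/-- The regressors grow at most like `N²` in mean square. -/
lemma exists_regMat_bound {G : ℝ × ℝ → ℝ} (hG : IntegrableOn G freqBox) {c C : ℝ} (hc : 0 < c)
    (hb : ∀ w ∈ freqBox, c ≤ G w ∧ G w ≤ C) {M : Matrix (Fin L) (Fin L) ℝ}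
    (h : Tendsto (fun N : ℕ => ((N : ℝ) ^ 2)⁻¹ •
      ((regMat N X)ᵀ * (covMat N G)⁻¹ * regMat N X)) atTop (𝓝 M)) :
    ∃ K, 0 ≤ K ∧ ∀ᶠ N : ℕ in atTop, ∀ v : Fin L → ℝ,
      (regMat N X *ᵥ v) ⬝ᵥ (regMat N X *ᵥ v) ≤ K * (N : ℝ) ^ 2 * (v ⬝ᵥ v) := by
  have hC : 0 < C := hc.trans_le ((hb 0 zero_mem_freqBox).1.trans (hb 0 zero_mem_freqBox).2)
  have hcont : Continuous fun A : Matrix (Fin L) (Fin L) ℝ => ∑ i, ∑ j, |A i j| := by fun_prop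
  set k := ∑ i, ∑ j, |M i j|
  have hk : 0 ≤ k := Finset.sum_nonneg fun i _ => Finset.sum_nonneg fun j _ => abs_nonneg _
  refine ⟨C * (k + 1), by positivity, ?_⟩
  filter_upwards [((hcont.tendsto M).comp h).eventually_le_const (lt_add_one k),
    eventually_gt_atTop 0] with N hN hN0 v
  have hpd := posDef_covMat hG hc (fun w hw => (hb w hw).1) N
  calc _ ≤ C * regQuad X N G v :=
        le_quad_inv hpd (quad_covMat_le_const hG (fun w hw => (hb w hw).2) N) _
    _ ≤ C * ((N : ℝ) ^ 2 * ((k + 1) * (v ⬝ᵥ v))) := by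
        rw [regQuad_eq X hN0]
        gcongr
        refine (quad_le_sum_abs _ v).trans ?_
        exact mul_le_mul_of_nonneg_right hN (dotProduct_self_nonneg_real v)
    _ = _ := by ring

lemma dotProduct_add_self_le {ι : Type*} [Fintype ι] (x h : ι → ℝ) :
    (x + h) ⬝ᵥ (x + h) ≤ 2 * (x ⬝ᵥ x) + 2 * (h ⬝ᵥ h) := by
  simp only [dotProduct, Finset.mul_sum, ← Finset.sum_add_distrib, Pi.add_apply]
  exact Finset.sum_le_sum fun i _ => by nlinarith [sq_nonneg (x i - h i)]

lemma dotProduct_self_eq_norm_sq (x : EuclideanSpace ℝ (Fin L)) :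
    (fun l => x l) ⬝ᵥ (fun l => x l) = ‖x‖ ^ 2 := by
  rw [EuclideanSpace.real_norm_sq_eq]
  simp only [dotProduct, sq]

/-- The increment of the log likelihood between two parameters whose spectra are within the
factor `1 + s` of each other. -/
lemma logLik_sub_le {N : ℕ} {θ θ' : EuclideanSpace ℝ (Fin p)} (hi : IntegrableOn (F θ) freqBox)
    (hi' : IntegrableOn (F θ') freqBox) {c : ℝ} (hc : 0 < c)
    (hb : ∀ w ∈ freqBox, c ≤ F θ w) (hb' : ∀ w ∈ freqBox, c ≤ F θ' w) {s : ℝ} (hs : 0 < s)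
    (h : ∀ w ∈ freqBox, F θ w ≤ (1 + s) * F θ' w) (h' : ∀ w ∈ freqBox, F θ' w ≤ (1 + s) * F θ w)
    (y : ℤ × ℤ → ℝ) (β β' : EuclideanSpace ℝ (Fin L)) :
    logLik F X N y θ' β' - logLik F X N y θ β ≤
      1 / 2 * s * (N : ℝ) ^ 2 + s * (c⁻¹ * (residual X N y β' ⬝ᵥ residual X N y β'))
        + 1 / 2 * (1 + s⁻¹) * (c⁻¹ * ((regMat N X *ᵥ (fun l => (β' - β) l)) ⬝ᵥ
          (regMat N X *ᵥ (fun l => (β' - β) l)))) := by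
  have hpd := posDef_covMat hi hc hb N
  obtain ⟨T, U, e, hS⟩ := exists_simDiag hpd (posDef_covMat hi' hc hb' N)
  have he : ∀ i, e i ≤ 1 + s := hS.eigen_le (quad_covMat_le hi' hi h' N)
  have he' : ∀ i, (e i)⁻¹ ≤ 1 + s := hS.inv_eigen_le (quad_covMat_le hi hi' h N)
  have hle := quad_inv_le hpd (const_le_quad_covMat hi hc hb N)
  set r := residual X N y β'
  set g := regMat N X *ᵥ (fun l => (β' - β) l)
  have h1 := hS.quad_inv_left r ▸ hle r
  have h2 := hS.quad_inv_left g ▸ hle g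
  have hcard : ∑ _i : Fin N × Fin N, (1 : ℝ) = (N : ℝ) ^ 2 := by simp [sq]
  rw [logLik_sub_eq hS, residual_eq_add X N y β β', mulVec_add]
  calc _ ≤ ∑ i, (1 / 2 * s * 1 + s * (U *ᵥ r) i ^ 2
        + 1 / 2 * (1 + s⁻¹) * (U *ᵥ g) i ^ 2) := by
        refine Finset.sum_le_sum fun i _ => ?_
        have hp := inv_pos.2 (hS.pos i)
        have h3 := Real.log_le_sub_one_of_pos hp
        have h4 := he' i
        -- From `e i ≤ 1 + s` and `(1 - s) (1 + s) ≤ 1`; for `s ≥ 1` the left side is nonpositive.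
        have h5 : 1 - s ≤ (e i)⁻¹ := by
          rw [← one_div, le_div_iff₀ (hS.pos i)]
          rcases le_total s 1 with hs1 | hs1
          · nlinarith [mul_le_mul_of_nonneg_left (he i) (sub_nonneg.2 hs1), sq_nonneg s]
          · nlinarith [mul_nonneg (sub_nonneg.2 hs1) (hS.pos i).le]
        -- Young's inequality with weight `s`: the residual keeps a coefficient near one, so it
        -- nearly cancels against `(e i)⁻¹`, and the small increment `g` takes the large weight
        -- `s⁻¹`.
        have h6 : ((U *ᵥ r) i + (U *ᵥ g) i) ^ 2
            ≤ (1 + s) * (U *ᵥ r) i ^ 2 + (1 + s⁻¹) * (U *ᵥ g) i ^ 2 := by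
          have h7 : (1 + s) * (U *ᵥ r) i ^ 2 + (1 + s⁻¹) * (U *ᵥ g) i ^ 2
              - ((U *ᵥ r) i + (U *ᵥ g) i) ^ 2
              = s⁻¹ * (s * (U *ᵥ r) i - (U *ᵥ g) i) ^ 2 := by field_simp; ring
          have h8 : 0 ≤ s⁻¹ * (s * (U *ᵥ r) i - (U *ᵥ g) i) ^ 2 := by positivity
          linarith
        have h9 := mul_le_mul_of_nonneg_right h5 (sq_nonneg ((U *ᵥ r) i))
        rw [Pi.add_apply]
        linarith
    _ = 1 / 2 * s * (N : ℝ) ^ 2 + s * ∑ i, (U *ᵥ r) i ^ 2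
        + 1 / 2 * (1 + s⁻¹) * ∑ i, (U *ᵥ g) i ^ 2 := by
        rw [Finset.sum_add_distrib, Finset.sum_add_distrib, ← Finset.mul_sum, ← Finset.mul_sum,
          ← Finset.mul_sum, hcard]
    _ ≤ _ := by gcongr

/-- The normalised log likelihood is equicontinuous in the parameter as long as the mean squares
of the regressors and of the true residuals stay bounded. -/
lemma exists_logLik_modulus (hA : RegularSpectra Θ F) (hΘ : IsCompact Θ) (hB : IsCompact B)
    (β₀ : EuclideanSpace ℝ (Fin L)) {K R : ℝ} (hK : 0 ≤ K) (hR : 0 ≤ R) {η : ℝ} (hη : 0 < η) :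
    ∃ ρ > 0, ∀ (N : ℕ) (y : ℤ × ℤ → ℝ),
      (∀ v : Fin L → ℝ,
        (regMat N X *ᵥ v) ⬝ᵥ (regMat N X *ᵥ v) ≤ K * (N : ℝ) ^ 2 * (v ⬝ᵥ v)) →
      residual X N y β₀ ⬝ᵥ residual X N y β₀ ≤ R * (N : ℝ) ^ 2 →
      ∀ φ ∈ Θ ×ˢ B, ∀ φ' ∈ Θ ×ˢ B, dist φ φ' < ρ →
        logLik F X N y φ'.1 φ'.2 ≤ logLik F X N y φ.1 φ.2 + η * (N : ℝ) ^ 2 := by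
  obtain ⟨c, C, hc, hb⟩ := hA.bounded
  obtain ⟨D, hD⟩ := hB.exists_bound_of_continuousOn (f := fun β => β₀ - β) (by fun_prop)
  set Q := c⁻¹ * (2 * R + 2 * (K * D ^ 2)) with hQ
  have hQ0 : 0 ≤ Q := by positivity
  -- The spectral tolerance `s` is fixed before the radius `ρ₂` in `β`, because `s⁻¹` multiplies the
  -- regression increment.
  obtain ⟨s, hs, hs1⟩ : ∃ s > 0, s * (1 / 2 + Q) ≤ η / 2 :=
    ⟨η / 2 / (1 / 2 + Q), by positivity, (div_mul_cancel₀ _ (by positivity)).le⟩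
  obtain ⟨ρ₂, hρ₂, hρ₂1⟩ : ∃ ρ > 0, 1 / 2 * (1 + s⁻¹) * (c⁻¹ * (K * ρ ^ 2)) ≤ η / 2 := by
    have hcont : Continuous fun ρ : ℝ => 1 / 2 * (1 + s⁻¹) * (c⁻¹ * (K * ρ ^ 2)) := by fun_prop
    have h0 := (hcont.tendsto 0).eventually_le_const (u := η / 2) (by simp; linarith)
    obtain ⟨ε, hε, hball⟩ := Metric.eventually_nhds_iff.1 h0
    refine ⟨ε / 2, by positivity, hball ?_⟩
    rw [Real.dist_eq, sub_zero, abs_of_pos (by positivity)]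
    linarith
  -- An additive error `c * s` is a relative error `s`, since the spectra are at least `c`.
  obtain ⟨ρ₁, hρ₁, huc⟩ := Metric.uniformContinuousOn_iff.1
    ((hΘ.prod isCompact_freqBox).uniformContinuousOn_of_continuous hA.continuousOn)
    (c * s) (by positivity)
  refine ⟨min ρ₁ ρ₂, lt_min hρ₁ hρ₂, ?_⟩
  rintro N y hreg hres ⟨θ, β⟩ ⟨hθ, hβ⟩ ⟨θ', β'⟩ ⟨hθ', hβ'⟩ hdist
  simp only at hθ hβ hθ' hβ' ⊢
  rw [Prod.dist_eq, max_lt_iff] at hdist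
  obtain ⟨hd1, hd2⟩ := hdist
  have hclose : ∀ {θ θ'}, θ ∈ Θ → θ' ∈ Θ → dist θ θ' < ρ₁ →
      ∀ w ∈ freqBox, F θ w ≤ (1 + s) * F θ' w := by
    intro θ θ' hθ hθ' hd w hw
    have h1 := huc (θ, w) ⟨hθ, hw⟩ (θ', w) ⟨hθ', hw⟩ (by simpa [Prod.dist_eq, hρ₁] using hd)
    rw [Real.dist_eq] at h1
    have h2 := (abs_lt.1 h1).2
    have h3 := mul_le_mul_of_nonneg_right (hb θ' hθ' w hw).1 hs.le
    simp only at h2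
    linarith
  have hd1' := hd1.trans_le (min_le_left _ _)
  have hd2' := hd2.trans_le (min_le_right _ _)
  have hmain := logLik_sub_le (X := X) (N := N) (hA.integrableOn hθ) (hA.integrableOn hθ') hc
    (fun w hw => (hb θ hθ w hw).1) (fun w hw => (hb θ' hθ' w hw).1) hs
    (hclose hθ hθ' hd1') (hclose hθ' hθ (by rwa [dist_comm])) y β β'
  have h1 : residual X N y β' ⬝ᵥ residual X N y β' ≤ (2 * R + 2 * (K * D ^ 2)) * (N : ℝ) ^ 2 := by
    rw [residual_eq_add X N y β' β₀]
    refine (dotProduct_add_self_le _ _).trans ?_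
    have h2 := hreg (fun l => (β₀ - β') l)
    rw [dotProduct_self_eq_norm_sq] at h2
    have h3 : K * (N : ℝ) ^ 2 * ‖β₀ - β'‖ ^ 2 ≤ K * (N : ℝ) ^ 2 * D ^ 2 := by
      gcongr; exact hD β' hβ'
    linarith
  have h2 : (regMat N X *ᵥ (fun l => (β' - β) l)) ⬝ᵥ (regMat N X *ᵥ (fun l => (β' - β) l))
      ≤ K * ρ₂ ^ 2 * (N : ℝ) ^ 2 := by
    have h3 := hreg (fun l => (β' - β) l)
    rw [dotProduct_self_eq_norm_sq] at h3
    have h4 : K * (N : ℝ) ^ 2 * ‖β' - β‖ ^ 2 ≤ K * (N : ℝ) ^ 2 * ρ₂ ^ 2 := by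
      gcongr
      rw [← dist_eq_norm, dist_comm]; exact hd2'.le
    linarith
  have h5 : s * (c⁻¹ * (residual X N y β' ⬝ᵥ residual X N y β')) ≤ s * Q * (N : ℝ) ^ 2 := by
    calc _ ≤ s * (c⁻¹ * ((2 * R + 2 * (K * D ^ 2)) * (N : ℝ) ^ 2)) := by gcongr
      _ = _ := by rw [hQ]; ring
  have h6 : 1 / 2 * (1 + s⁻¹) * (c⁻¹ * ((regMat N X *ᵥ (fun l => (β' - β) l)) ⬝ᵥ
          (regMat N X *ᵥ (fun l => (β' - β) l)))) ≤ η / 2 * (N : ℝ) ^ 2 := by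
    calc _ ≤ 1 / 2 * (1 + s⁻¹) * (c⁻¹ * (K * ρ₂ ^ 2 * (N : ℝ) ^ 2)) := by gcongr
      _ = 1 / 2 * (1 + s⁻¹) * (c⁻¹ * (K * ρ₂ ^ 2)) * (N : ℝ) ^ 2 := by ring
      _ ≤ _ := by gcongr
  have h7 := mul_le_mul_of_nonneg_right hs1 (sq_nonneg (N : ℝ))
  linarith

end Uniformity

/-! ### Continuity of the log likelihood in the parameters. -/

section Continuity

open Matrix

variable {p L : ℕ} {Θ : Set (EuclideanSpace ℝ (Fin p))}
  {F : EuclideanSpace ℝ (Fin p) → ℝ × ℝ → ℝ}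

lemma RegularSpectra.continuousOn_acf (hA : RegularSpectra Θ F) (t : ℤ × ℤ) :
    ContinuousOn (fun θ => acf (F θ) t) Θ := by
  obtain ⟨c, C, hc, hb⟩ := hA.bounded
  have h1 : ContinuousOn (fun θ => (4 * Real.pi ^ 2)⁻¹ *
      ∫ w in freqBox, F θ w * Real.cos (phase t w)) Θ := by
    refine continuousOn_const.mul (continuousOn_of_dominated (bound := fun _ => C) ?_ ?_ ?_ ?_)
    · intro θ hθ
      exact (integrableOn_mul_continuous (hA.integrableOn hθ)
        (Real.continuous_cos.comp (continuous_phase t))).aestronglyMeasurable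
    · intro θ hθ
      filter_upwards [ae_restrict_mem measurableSet_freqBox] with w hw
      have h2 := hb θ hθ w hw
      rw [norm_mul, Real.norm_eq_abs, Real.norm_eq_abs, abs_of_pos (hc.trans_le h2.1)]
      have h3 := Real.abs_cos_le_one (phase t w)
      have h4 := hc.trans_le h2.1
      nlinarith [abs_nonneg (Real.cos (phase t w))]
    · exact ContinuousOn.integrableOn_compact isCompact_freqBox continuousOn_const
    · filter_upwards [ae_restrict_mem measurableSet_freqBox] with w hw
      refine ContinuousOn.mul ?_ continuousOn_const
      exact hA.continuousOn.comp (f := fun θ => (θ, w)) (by fun_prop) fun θ hθ => ⟨hθ, hw⟩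
  exact h1.congr fun θ hθ => acf_eq (hA.integrableOn hθ) t

/-- This makes the posterior integrands integrable, the prior being carried by a compact set. -/
lemma RegularSpectra.continuousOn_logLik (hA : RegularSpectra Θ F) (X : Fin L → ℤ × ℤ → ℝ)
    (N : ℕ) (y : ℤ × ℤ → ℝ) (B : Set (EuclideanSpace ℝ (Fin L))) :
    ContinuousOn (fun φ : EuclideanSpace ℝ (Fin p) × EuclideanSpace ℝ (Fin L) =>
      logLik F X N y φ.1 φ.2) (Θ ×ˢ B) := by
  obtain ⟨c, C, hc, hb⟩ := hA.bounded
  have hcov : ContinuousOn (fun φ : EuclideanSpace ℝ (Fin p) × EuclideanSpace ℝ (Fin L) =>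
      covMat N (F φ.1)) (Θ ×ˢ B) := by
    refine continuousOn_pi.2 fun i => continuousOn_pi.2 fun j => ?_
    exact (hA.continuousOn_acf _).comp continuousOn_fst fun φ hφ => hφ.1
  have hdet : ContinuousOn (fun φ : EuclideanSpace ℝ (Fin p) × EuclideanSpace ℝ (Fin L) =>
      (covMat N (F φ.1)).det) (Θ ×ˢ B) :=
    (Continuous.matrix_det continuous_id).comp_continuousOn hcov
  have hdet0 : ∀ φ ∈ Θ ×ˢ B, (covMat N (F φ.1)).det ≠ 0 := fun φ hφ =>
    (posDef_covMat (hA.integrableOn hφ.1) hc (fun w hw => (hb _ hφ.1 w hw).1) N).det_pos.ne'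
  have hinv : ContinuousOn (fun φ : EuclideanSpace ℝ (Fin p) × EuclideanSpace ℝ (Fin L) =>
      (covMat N (F φ.1))⁻¹) (Θ ×ˢ B) := by
    simp only [Matrix.inv_def, Ring.inverse_eq_inv']
    exact (hdet.inv₀ hdet0).smul ((Continuous.matrix_adjugate continuous_id).comp_continuousOn hcov)
  have hres : Continuous (fun φ : EuclideanSpace ℝ (Fin p) × EuclideanSpace ℝ (Fin L) =>
      residual X N y φ.2) := by
    unfold residual; fun_prop
  have hform : Continuous fun q : Matrix (Fin N × Fin N) (Fin N × Fin N) ℝ ×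
      (Fin N × Fin N → ℝ) => q.2 ⬝ᵥ (q.1 *ᵥ q.2) := by fun_prop
  exact (continuousOn_const.mul (hdet.log hdet0)).sub (continuousOn_const.mul
    (hform.comp_continuousOn (hinv.prodMk hres.continuousOn)))

end Continuity

/-! ### Concentration of the posterior and consistency. -/

section Posterior

/-- Concentration of a Gibbs measure: if the exponent is smaller by `a` away from `φ₀`, and by at
most `a / 2` near `φ₀`, then the mean of `g` is close to `g φ₀`. -/
lemma norm_gibbs_mean_sub_le {E E' : Type*} [PseudoMetricSpace E] [MeasurableSpace E]
    [BorelSpace E] [NormedAddCommGroup E'] [NormedSpace ℝ E'] [CompleteSpace E'] {μ : Measure E}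
    [IsProbabilityMeasure μ] {S : Set E} (hS : ∀ᵐ φ ∂μ, φ ∈ S) {f : E → ℝ} {g : E → E'}
    (hf : Integrable (fun φ => Real.exp (f φ)) μ)
    (hfg : Integrable (fun φ => Real.exp (f φ) • g φ) μ) {φ₀ : E} {a f₀ r ρ D : ℝ} (hr : 0 ≤ r)
    (hD : ∀ φ ∈ S, ‖g φ - g φ₀‖ ≤ D) (hnear : ∀ φ ∈ S, dist φ φ₀ < r → ‖g φ - g φ₀‖ ≤ r)
    (hup : ∀ φ ∈ S, r ≤ dist φ φ₀ → f φ ≤ f₀ - a)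
    (hlow : ∀ φ ∈ S, dist φ φ₀ < ρ → f₀ - a / 2 ≤ f φ)
    (hball : 0 < μ (Metric.ball φ₀ ρ)) (hD0 : 0 ≤ D) :
    ‖(∫ φ, Real.exp (f φ) ∂μ)⁻¹ • ∫ φ, Real.exp (f φ) • g φ ∂μ - g φ₀‖ ≤
      r + D * Real.exp (-(a / 2)) / μ.real (Metric.ball φ₀ ρ) := by
  set Z := ∫ φ, Real.exp (f φ) ∂μ with hZ
  set b := μ.real (Metric.ball φ₀ ρ) with hb
  have hbpos : 0 < b := ENNReal.toReal_pos hball.ne' (measure_ne_top _ _)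
  have hZlow : Real.exp (f₀ - a / 2) * b ≤ Z := by
    calc Real.exp (f₀ - a / 2) * b = ∫ φ in Metric.ball φ₀ ρ, Real.exp (f₀ - a / 2) ∂μ := by
          rw [setIntegral_const, smul_eq_mul, mul_comm]
      _ ≤ ∫ φ in Metric.ball φ₀ ρ, Real.exp (f φ) ∂μ := by
          refine setIntegral_mono_on_ae (integrable_const _).integrableOn hf.integrableOn
            Metric.isOpen_ball.measurableSet ?_
          filter_upwards [hS] with φ hφ hφb
          exact Real.exp_le_exp.2 (hlow φ hφ hφb)
      _ ≤ Z := setIntegral_le_integral hf (ae_of_all _ fun φ => (Real.exp_pos _).le)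
  have hZpos : 0 < Z := lt_of_lt_of_le (by positivity) hZlow
  have hconst : Integrable (fun φ => Real.exp (f φ) • g φ₀) μ := hf.smul_const _
  have hdiff : Z⁻¹ • ∫ φ, Real.exp (f φ) • g φ ∂μ - g φ₀
      = Z⁻¹ • ∫ φ, Real.exp (f φ) • (g φ - g φ₀) ∂μ := by
    simp only [smul_sub]
    rw [integral_sub hfg hconst, smul_sub, integral_smul_const, ← hZ,
      inv_smul_smul₀ hZpos.ne']
  -- The ball of radius `r` contributes at most `r * Z`, its complement the second term; against
  -- `hZlow` the latter retains a factor `exp (-(a / 2))`.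
  have hbound : ‖∫ φ, Real.exp (f φ) • (g φ - g φ₀) ∂μ‖ ≤ r * Z + D * Real.exp (f₀ - a) := by
    calc _ ≤ ∫ φ, (r * Real.exp (f φ) + D * Real.exp (f₀ - a)) ∂μ := by
          refine norm_integral_le_of_norm_le ((hf.const_mul r).add (integrable_const _)) ?_
          filter_upwards [hS] with φ hφ
          rw [norm_smul, Real.norm_eq_abs, Real.abs_exp]
          rcases lt_or_ge (dist φ φ₀) r with h | h
          · have h1 := mul_le_mul_of_nonneg_left (hnear φ hφ h) (Real.exp_pos (f φ)).le
            have h2 : 0 ≤ D * Real.exp (f₀ - a) := by positivity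
            linarith
          · have h1 := mul_le_mul (Real.exp_le_exp.2 (hup φ hφ h)) (hD φ hφ) (norm_nonneg _)
              (Real.exp_pos _).le
            have h2 : 0 ≤ r * Real.exp (f φ) := by positivity
            linarith
      _ = _ := by
          rw [integral_add (hf.const_mul r) (integrable_const _), integral_const_mul,
            integral_const, probReal_univ, one_smul]
  have hexp : Real.exp (f₀ - a) = Real.exp (f₀ - a / 2) * Real.exp (-(a / 2)) := by
    rw [← Real.exp_add]; congr 1; ring
  rw [hdiff, norm_smul, norm_inv, Real.norm_of_nonneg hZpos.le, inv_mul_le_iff₀ hZpos]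
  refine hbound.trans ?_
  have h3 : D * Real.exp (f₀ - a) ≤ Z * (D * Real.exp (-(a / 2)) / b) := by
    calc D * Real.exp (f₀ - a)
        = (Real.exp (f₀ - a / 2) * b) * (D * Real.exp (-(a / 2)) / b) := by
          rw [hexp]; field_simp
      _ ≤ _ := by gcongr
  linarith

variable {Ω : Type*} [MeasurableSpace Ω] {P : Measure Ω} [IsProbabilityMeasure P] {p L : ℕ}
  {Θ : Set (EuclideanSpace ℝ (Fin p))} {B : Set (EuclideanSpace ℝ (Fin L))}
  {F : EuclideanSpace ℝ (Fin p) → ℝ × ℝ → ℝ} {X : Fin L → ℤ × ℤ → ℝ}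
  {β₀ : EuclideanSpace ℝ (Fin L)} {Y : ℤ × ℤ → Ω → ℝ} {θ₀ : EuclideanSpace ℝ (Fin p)}
  {M : EuclideanSpace ℝ (Fin p) → Matrix (Fin L) (Fin L) ℝ}

/-- The mean square of the true residuals is bounded with high probability. -/
lemma DataModel.whp_residual_le {F₀ : ℝ × ℝ → ℝ} (h : DataModel P F₀ X β₀ Y)
    (hF : IntegrableOn F₀ freqBox) {c C : ℝ} (hc : 0 < c)
    (hb : ∀ w ∈ freqBox, c ≤ F₀ w ∧ F₀ w ≤ C) :
    Whp P fun N ω => dotProduct (residual X N (fun t => Y t ω) β₀)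
      (residual X N (fun t => Y t ω) β₀) ≤ 2 * C * (N : ℝ) ^ 2 := by
  have hC : 0 < C := hc.trans_le ((hb 0 zero_mem_freqBox).1.trans (hb 0 zero_mem_freqBox).2)
  have hpd := posDef_covMat hF hc (fun w hw => (hb w hw).1)
  choose T U e hS using fun N => exists_simDiag (hpd N) (hpd N)
  -- With these coefficients the sum of the squared standardised residuals is within `N²` of its
  -- mean `N²`, which gives the factor 2.
  have hw := h.whp_quadratic hF (U := U) (fun N => (hS N).conj_left) (a := fun _ _ => 1)
    (b := fun _ _ => 0) (K := 1) (Eventually.of_forall fun N => by simp [sq])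
    (Eventually.of_forall fun N => by simp) one_pos
  refine hw.mono (Eventually.of_forall fun N ω hω => ?_)
  have h1 := le_quad_inv (hpd N) (quad_covMat_le_const hF (fun w hw => (hb w hw).2) N)
    (residual X N (fun t => Y t ω) β₀)
  rw [(hS N).quad_inv_left] at h1
  have h2 := (abs_le.1 hω).2
  simp only [one_mul, zero_mul, add_zero, Finset.sum_sub_distrib, Finset.sum_const,
    Finset.card_univ, Fintype.card_prod, Fintype.card_fin, nsmul_eq_mul, mul_one,
    Nat.cast_mul] at h2
  refine h1.trans ?_
  calc _ ≤ C * (2 * (N : ℝ) ^ 2) := by gcongr; linarith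
    _ = _ := by ring

/-- Consistency of posterior means of Lipschitz functions of the parameter. -/
lemma whp_posteriorExp_sub_lt {E' : Type*} [NormedAddCommGroup E'] [NormedSpace ℝ E']
    [CompleteSpace E'] (hΘ : IsCompact Θ) (hB : IsCompact B)
    (hA : RegularSpectra Θ F) (hid : Identifiable Θ F) (hθ₀ : θ₀ ∈ Θ)
    (hY : DataModel P (F θ₀) X β₀ Y)
    (hlim : ∀ θ ∈ Θ, Tendsto (fun N : ℕ => ((N : ℝ) ^ 2)⁻¹ •
        ((regMat N X).transpose * (covMat N (F θ))⁻¹ * regMat N X)) atTop (𝓝 (M θ)))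
    (hpos : ∀ θ ∈ Θ, (M θ).PosDef)
    {prior : Measure (EuclideanSpace ℝ (Fin p) × EuclideanSpace ℝ (Fin L))}
    [IsProbabilityMeasure prior] (hprior : ∀ᵐ φ ∂prior, φ ∈ Θ ×ˢ B)
    (hprior₀ : ∀ U ∈ 𝓝 (θ₀, β₀), 0 < prior U) (hβ₀ : β₀ ∈ B)
    {g : EuclideanSpace ℝ (Fin p) × EuclideanSpace ℝ (Fin L) → E'} (hg : LipschitzWith 1 g)
    {ε : ℝ} (hε : 0 < ε) :
    Whp P fun N ω => ‖posteriorExp F X prior N (fun t => Y t ω) g - g (θ₀, β₀)‖ < ε := by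
  obtain ⟨c, C, hc, hb⟩ := hA.bounded
  have hC : 0 < C := hc.trans_le ((hb θ₀ hθ₀ 0 zero_mem_freqBox).1.trans
    (hb θ₀ hθ₀ 0 zero_mem_freqBox).2)
  obtain ⟨K, hK, hreg⟩ := exists_regMat_bound (hA.integrableOn hθ₀) hc (hb θ₀ hθ₀) (hlim θ₀ hθ₀)
  have hres := hY.whp_residual_le (hA.integrableOn hθ₀) hc (hb θ₀ hθ₀)
  have hcomp := hΘ.prod hB
  set φ₀ := (θ₀, β₀) with hφ₀
  have hmem₀ : φ₀ ∈ Θ ×ˢ B := ⟨hθ₀, hβ₀⟩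
  have hdist : ∀ φ, ‖g φ - g φ₀‖ ≤ dist φ φ₀ := fun φ => by
    rw [← dist_eq_norm]; simpa using hg.dist_le_mul φ φ₀
  obtain ⟨D, hD⟩ := hcomp.exists_bound_of_continuousOn (f := fun φ => dist φ φ₀) (by fun_prop)
  have hD0 : 0 ≤ D := (norm_nonneg _).trans (hD φ₀ hmem₀)
  set r := ε / 2 with hr
  have hfar : ∃ δ > 0, Whp P fun N ω => ∀ φ ∈ (Θ ×ˢ B) \ Metric.ball φ₀ r,
      logLik F X N (fun t => Y t ω) φ.1 φ.2
        ≤ logLik F X N (fun t => Y t ω) θ₀ β₀ - δ * (N : ℝ) ^ 2 := by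
    -- Compactness: a finite cover by balls on each of which the gap at the centre persists, up to
    -- half of it, by equicontinuity.
    refine (hcomp.diff Metric.isOpen_ball).induction_on
      (p := fun S => ∃ δ > 0, Whp P fun N ω => ∀ φ ∈ S, logLik F X N (fun t => Y t ω) φ.1 φ.2
        ≤ logLik F X N (fun t => Y t ω) θ₀ β₀ - δ * (N : ℝ) ^ 2) ?_ ?_ ?_ ?_
    · exact ⟨1, one_pos, by simp [Whp]⟩
    · rintro s t hst ⟨δ, hδ, h⟩
      exact ⟨δ, hδ, h.mono (Eventually.of_forall fun N ω hω φ hφ => hω φ (hst hφ))⟩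
    · rintro s t ⟨δ, hδ, h⟩ ⟨δ', hδ', h'⟩
      refine ⟨min δ δ', lt_min hδ hδ', (h.and h').mono (Eventually.of_forall
        fun N ω hω φ hφ => ?_)⟩
      have hN := sq_nonneg (N : ℝ)
      rcases hφ with hφ | hφ
      · linarith [hω.1 φ hφ, mul_le_mul_of_nonneg_right (min_le_left δ δ') hN]
      · linarith [hω.2 φ hφ, mul_le_mul_of_nonneg_right (min_le_right δ δ') hN]
    · rintro ψ ⟨hψ, hψr⟩
      have hne : (ψ.1, ψ.2) ≠ (θ₀, β₀) := by
        intro h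
        exact hψr (by rw [show ψ = φ₀ from h]; exact Metric.mem_ball_self (by positivity))
      obtain ⟨δ, hδ, hw⟩ := whp_logLik_le hA hid hθ₀ hY hlim hpos hψ.1 hne
      obtain ⟨ρ, hρ, hmod⟩ := exists_logLik_modulus (X := X) hA hΘ hB β₀ hK
        (by positivity : 0 ≤ 2 * C) (half_pos hδ)
      refine ⟨(Θ ×ˢ B) ∩ Metric.ball ψ ρ, ?_, δ / 2, half_pos hδ, ?_⟩
      · refine inter_mem ?_ (mem_nhdsWithin_of_mem_nhds (Metric.ball_mem_nhds _ hρ))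
        exact mem_of_superset self_mem_nhdsWithin Set.sdiff_subset
      · refine (hw.and hres).mono ?_
        filter_upwards [hreg] with N hN ω hω φ hφ
        have h1 := hmod N (fun t => Y t ω) hN hω.2 ψ hψ φ hφ.1 (by
          rw [dist_comm]; exact hφ.2)
        linarith [hω.1]
  obtain ⟨δ, hδ, hfar⟩ := hfar
  -- The tolerance `δ / 2` is the `a / 2` of the Gibbs bound with `a = δ N²`. As `ρ` does not depend
  -- on `N`, neither does the prior mass `b` of the ball.
  obtain ⟨ρ, hρ, hmod⟩ := exists_logLik_modulus (X := X) hA hΘ hB β₀ hK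
    (by positivity : 0 ≤ 2 * C) (half_pos hδ)
  set b := prior.real (Metric.ball φ₀ ρ)
  have hball := hprior₀ _ (Metric.ball_mem_nhds φ₀ hρ)
  have htend : Tendsto (fun N : ℕ => D * Real.exp (-(δ * (N : ℝ) ^ 2 / 2)) / b) atTop (𝓝 0) := by
    have h1 : Tendsto (fun N : ℕ => δ * (N : ℝ) ^ 2 / 2) atTop atTop :=
      (((tendsto_pow_atTop two_ne_zero).comp tendsto_natCast_atTop_atTop).const_mul_atTop
        hδ).atTop_div_const two_pos
    have h2 := ((Real.tendsto_exp_neg_atTop_nhds_zero.comp h1).const_mul D).div_const b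
    simpa using h2
  refine (hfar.and hres).mono ?_
  filter_upwards [hreg, htend.eventually_lt_const (half_pos hε)] with N hN hsmall ω hω
  have hcont := hA.continuousOn_logLik X N (fun t => Y t ω) B
  have hrestr : prior.restrict (Θ ×ˢ B) = prior := Measure.restrict_eq_self_of_ae_mem hprior
  have hexp := hcont.rexp
  have hi1 : Integrable (fun φ => Real.exp (logLik F X N (fun t => Y t ω) φ.1 φ.2)) prior := by
    rw [← hrestr]
    exact hexp.integrableOn_compact hcomp
  have hi2 : Integrable (fun φ => Real.exp (logLik F X N (fun t => Y t ω) φ.1 φ.2) • g φ)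
      prior := by
    rw [← hrestr]
    exact (hexp.smul hg.continuous.continuousOn).integrableOn_compact hcomp
  have hfin := norm_gibbs_mean_sub_le (r := r) (ρ := ρ) (D := D) (a := δ * (N : ℝ) ^ 2)
    (f₀ := logLik F X N (fun t => Y t ω) θ₀ β₀) (φ₀ := φ₀) hprior hi1 hi2 (by positivity)
    (fun φ hφ => (hdist φ).trans ((le_abs_self _).trans (hD φ hφ)))
    (fun φ _ h => (hdist φ).trans h.le)
    (fun φ hφ h => hω.1 φ ⟨hφ, fun h' => not_lt.2 h h'⟩)
    (fun φ hφ h => by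
      have h1 := hmod N (fun t => Y t ω) hN hω.2 φ hφ φ₀ hmem₀ h
      simp only [hφ₀] at h1
      linarith) hball hD0
  refine lt_of_le_of_lt hfin ?_
  linarith

end Posterior

end LatticeField

end

theorem mainTheorem2 {Ω : Type*} [MeasurableSpace Ω] (P : Measure Ω) [IsProbabilityMeasure P]
    {p L : ℕ}
    -- the compact parameter space `Θ × B` and the family of spectra
    (Θ : Set (EuclideanSpace ℝ (Fin p))) (B : Set (EuclideanSpace ℝ (Fin L)))
    (hΘ : IsCompact Θ) (hB : IsCompact B)
    (F : EuclideanSpace ℝ (Fin p) → ℝ × ℝ → ℝ)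
    (hA2 : LatticeField.RegularSpectra Θ F) (hid : LatticeField.Identifiable Θ F)
    -- the true parameters
    (θ₀ : EuclideanSpace ℝ (Fin p)) (β₀ : EuclideanSpace ℝ (Fin L))
    (hθ₀ : θ₀ ∈ interior Θ) (hβ₀ : β₀ ∈ interior B)
    -- the Gaussian data field, with correctly specified regressors and spectrum
    (X : Fin L → ℤ × ℤ → ℝ) (Y : ℤ × ℤ → Ω → ℝ)
    (hgauss : IsGaussianProcess Y P)
    (hmean : ∀ t, ∫ ω, Y t ω ∂P = ∑ l, β₀ l * X l t)
    (hcov : ∀ s t, cov[Y s, Y t; P] = LatticeField.acf (F θ₀) (t - s))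
    -- the condition on the regression matrix
    (M : EuclideanSpace ℝ (Fin p) → Matrix (Fin L) (Fin L) ℝ)
    (hlim : ∀ θ ∈ Θ, Tendsto
      (fun N : ℕ => ((N : ℝ) ^ 2)⁻¹ •
        ((LatticeField.regMat N X).transpose * (LatticeField.covMat N (F θ))⁻¹ * LatticeField.regMat N X))
      atTop (𝓝 (M θ)))
    (hpos : ∀ θ ∈ Θ, (M θ).PosDef)
    (hM : ∃ lo hi : ℝ, 0 < lo ∧ ∀ θ ∈ Θ, spectrum ℝ (M θ) ⊆ Set.Icc lo hi)
    -- the prior: a law on the parameter space that charges every neighbourhood of the truth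
    (prior : Measure (EuclideanSpace ℝ (Fin p) × EuclideanSpace ℝ (Fin L)))
    [IsProbabilityMeasure prior]
    (hprior : ∀ᵐ φ ∂prior, φ ∈ Θ ×ˢ B)
    (hprior₀ : ∀ U ∈ 𝓝 (θ₀, β₀), 0 < prior U) :
    TendstoInMeasure P
        (fun (N : ℕ) ω => LatticeField.posteriorExp F X prior N (fun t => Y t ω) Prod.snd)
        atTop (fun _ => β₀) ∧
      TendstoInMeasure P
        (fun (N : ℕ) ω => LatticeField.posteriorExp F X prior N (fun t => Y t ω) Prod.fst)
        atTop (fun _ => θ₀) := by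
  have hY : LatticeField.DataModel P (F θ₀) X β₀ Y := ⟨hgauss, hmean, hcov⟩
  -- Both coordinate projections are 1-Lipschitz.
  exact ⟨LatticeField.tendstoInMeasure_of_whp fun ε hε =>
      LatticeField.whp_posteriorExp_sub_lt hΘ hB hA2 hid (interior_subset hθ₀) hY hlim hpos hprior
        hprior₀ (interior_subset hβ₀) LipschitzWith.prod_snd hε,
    LatticeField.tendstoInMeasure_of_whp fun ε hε =>
      LatticeField.whp_posteriorExp_sub_lt hΘ hB hA2 hid (interior_subset hθ₀) hY hlim hpos hprior
        hprior₀ (interior_subset hβ₀) LipschitzWith.prod_fst hε⟩
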